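/- Let $(\xi_k)_{k\in I}$ be a countable family of independent standard Gaussian random variables on a probability space, and let $(q_k)_{k\in I}$ be weights with $q_k>1$ and $\sum_k 1/q_k<1$. For multi-indices $\alpha\in\mathcal J$ (finitely supported families of non-negative integers) put $\alpha!=\prod_k\alpha_k!$, $z^\alpha=\prod_k z_k^{\alpha_k}$, $q^{\ell\alpha}=\prod_k q_k^{\ell\alpha_k}$ and $\xi_\alpha=(\alpha!)^{-1/2}\prod_k \mathrm{He}_{\alpha_k}(\xi_k)$, where $\mathrm{He}_n$ are the Hermite polynomials orthogonal for the standard Gaussian law. For a complex Hilbert space $V$, $(\mathcal S)_{-\rho,-\ell}(V)$ is the space of formal chaos series $\Phi=\sum_\alpha\Phi_\alpha\xi_\alpha$, $\Phi_\alpha\in V$, with $$\sum_\alpha (\alpha!)^{-\rho}q^{-\ell\alpha}\|\Phi_\alpha\|_V^2<\infty ,$$ and $(\mathcal S)_{-1}(V)=\bigcup_{\ell\in\mathbb N}(\mathcal S)_{-1,-\ell}(V)$. The S-transform of $\Phi$ is $\widetilde\Phi(z)=\sum_\alpha (\alpha!)^{-1/2}z^\alpha\Phi_\alpha$, and the Wick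 product $\diamond$ corresponds to the product of S-transforms. Let $0<T<\infty$. A solution of the Wick Burgers equation $$u_t+u\diamond u_x=u_{xx},\qquad 0<t\le T,\ x\in\mathbb R,$$ with initial condition $u(0,\cdot)=u_0$ is an element $u\in(\mathcal S)_{-1}\big(L_2((0,T);H^2(\mathbb R))\big)$ for which there are $R,\ell'\in(0,\infty)$ such that, for every complex family $z$ with $\sum_{\alpha\ne0}q^{\ell'\alpha}|z^\alpha|^2<R^2$ and all $t\in[0,T]$, $$\widetilde u(t,\cdot;z)+\int_0^t\widetilde u(s,\cdot;z)\,\widetilde u_x(s,\cdot;z)\,ds=\widetilde u_0(\cdot;z)+\int_0^t\widetilde u_{xx}(s,\cdot;z)\,ds\quad\text{in }L_2(\mathbb R)$$ (for a suitable version of $\widetilde u(\cdot,\cdot;z)$ in $t$). **Theorem.** Let $\phi:\mathbb R\to\mathbb R$ be smooth with compact support and not identically zero, and let $\xi=\xi_k$ be one of the given standard Gaussian random variables. Then, for all $0\le\rho<1$ and $\ell>0$, the Wick Burgers equation with initial condition $u(0,x)=\xi\,\phi(x)$ has no solution that belongs to $(\mathcal S)_{-\rho,-\ell}\big(L_2((0,T);H^2(\mathbb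 R))\big)$. -/

import Mathlib

open MeasureTheory ProbabilityTheory Set
open scoped ENNReal ContDiff

noncomputable section

namespace WickBurgers

/-! ### Multi-indices, chaos basis, spaces of generalized random elements -/

/-- Multi-indices: finitely supported families of natural numbers. -/
abbrev MIdx (ι : Type*) := ι →₀ ℕ

/-- `α! = ∏ₖ αₖ!`. -/
def mfact {ι : Type*} (α : MIdx ι) : ℕ := α.prod fun _ n => n.factorial

/-- `z^α = ∏ₖ zₖ^αₖ`. -/
def mpow {ι M : Type*} [CommMonoid M] (z : ι → M) (α : MIdx ι) : M := α.prod fun k n => z k ^ n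

/-- The weights `q`: `1 < qₖ` and `∑ₖ 1/qₖ < 1`. -/
structure IsWeight {ι : Type*} (q : ι → ℝ) : Prop where
  one_lt : ∀ k, 1 < q k
  summable_inv : Summable fun k => (q k)⁻¹
  tsum_inv_lt : ∑' k, (q k)⁻¹ < 1

/-- `ξ_α = (α!)^{-1/2} ∏ₖ He_{αₖ}(ξₖ)`, with the probabilists' Hermite polynomials `He_n`. -/
def xiBasis {ι Ω : Type*} (ξ : ι → Ω → ℝ) (α : MIdx ι) (a : Ω) : ℝ :=
  (√(mfact α : ℝ))⁻¹ * α.prod fun k n => Polynomial.aeval (ξ k a) (Polynomial.hermite n)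

/-- The chaos coefficients `F_α = 𝔼 (F ξ_α)` of a square-integrable `V`-valued random element. -/
def chaosCoeff {ι Ω V : Type*} [MeasurableSpace Ω] [NormedAddCommGroup V] [NormedSpace ℂ V]
    (P : Measure Ω) (ξ : ι → Ω → ℝ) (F : Ω → V) (α : MIdx ι) : V :=
  ∫ a, (xiBasis ξ α a : ℂ) • F a ∂P

/-- A generalized random element `Φ = ∑_α Φ_α ξ_α` is given by the family `Φ` of its chaos
coefficients. `MemS q ρ ℓ Φ` says that it belongs to `(S)_{-ρ,-ℓ}(V)`, the completion of the
square-integrable chaos series in the norm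
`‖Φ‖² = ∑_α (α!)^{-ρ} q^{-ℓα} ‖Φ_α‖²`, which is a weighted `ℓ²` space. -/
def MemS {ι V : Type*} [NormedAddCommGroup V] (q : ι → ℝ) (ρ ℓ : ℝ) (Φ : MIdx ι → V) : Prop :=
  Summable fun α => (mfact α : ℝ) ^ (-ρ) * (mpow q α) ^ (-ℓ) * ‖Φ α‖ ^ 2

/-- `(S)_{-1}(V)`, the union over natural `ℓ` of the spaces `(S)_{-1,-ℓ}(V)`. -/
def MemKondratiev {ι V : Type*} [NormedAddCommGroup V] (q : ι → ℝ) (Φ : MIdx ι → V) : Prop :=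
  ∃ ℓ : ℕ, MemS q 1 ℓ Φ

/-- The S-transform `Φ~(z) = ∑_α (α!)^{-1/2} z^α Φ_α`. -/
def sTransform {ι V : Type*} [NormedAddCommGroup V] [NormedSpace ℂ V]
    (Φ : MIdx ι → V) (z : ι → ℂ) : V :=
  ∑' α, (mpow z α / (√(mfact α : ℝ) : ℂ)) • Φ α

/-- The neighborhood `K_ℓ(R)` of `z = 0`: `∑_{α ≠ 0} q^{ℓα} |z^α|² < R²`. (The term of `α = 0` is
always equal to `1`, so leaving it out only replaces `R²` by `R² + 1`; with it, the set would be
empty for `R ≤ 1`.) -/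
def nbhd {ι : Type*} (q : ι → ℝ) (ℓ R : ℝ) : Set (ι → ℂ) :=
  {z | Summable (fun α : {α : MIdx ι // α ≠ 0} => (mpow q α.1) ^ ℓ * ‖mpow z α.1‖ ^ 2) ∧
    ∑' α : {α : MIdx ι // α ≠ 0}, (mpow q α.1) ^ ℓ * ‖mpow z α.1‖ ^ 2 < R ^ 2}

/-! ### The spaces `L₂(ℝ)`, `H²(ℝ)` and `L₂((0,T);H²(ℝ))` -/

/-- Complex-valued `L₂(ℝ)`. -/
abbrev L2R := Lp ℂ 2 (volume : Measure ℝ)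

/-- `g` is the weak (distributional) derivative of `f`. -/
def IsWeakDeriv (f g : L2R) : Prop :=
  ∀ ψ : ℝ → ℝ, ContDiff ℝ ∞ ψ → HasCompactSupport ψ →
    ∫ x, ((deriv ψ x : ℝ) : ℂ) * f x = -∫ x, ((ψ x : ℝ) : ℂ) * g x

theorem memLp_of_testFunction {ψ : ℝ → ℝ} (h : Continuous ψ) (hc : HasCompactSupport ψ) :
    MemLp (fun x => ((ψ x : ℝ) : ℂ)) 2 volume :=
  (Complex.continuous_ofReal.comp h).memLp_of_hasCompactSupport
    (hc.comp_left (g := fun r : ℝ => (r : ℂ)) Complex.ofReal_zero)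

theorem integrable_testFunction_mul {ψ : ℝ → ℝ} (h : Continuous ψ) (hc : HasCompactSupport ψ)
    (f : L2R) : Integrable (fun x => ((ψ x : ℝ) : ℂ) * f x) volume :=
  (memLp_of_testFunction h hc).integrable_mul (Lp.memLp f)

theorem integral_testFunction_mul_add {ψ : ℝ → ℝ} (h : Continuous ψ) (hc : HasCompactSupport ψ)
    (f g : L2R) : ∫ x, ((ψ x : ℝ) : ℂ) * (f + g : L2R) x =
      (∫ x, ((ψ x : ℝ) : ℂ) * f x) + ∫ x, ((ψ x : ℝ) : ℂ) * g x := by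
  rw [← integral_add (integrable_testFunction_mul h hc f) (integrable_testFunction_mul h hc g)]
  refine integral_congr_ae ?_
  filter_upwards [Lp.coeFn_add f g] with x hx
  rw [hx, Pi.add_apply, mul_add]

theorem integral_testFunction_mul_smul (ψ : ℝ → ℝ) (c : ℂ) (f : L2R) :
    ∫ x, ((ψ x : ℝ) : ℂ) * (c • f : L2R) x = c * ∫ x, ((ψ x : ℝ) : ℂ) * f x := by
  rw [← integral_const_mul]
  refine integral_congr_ae ?_
  filter_upwards [Lp.coeFn_smul c f] with x hx
  rw [hx, Pi.smul_apply, smul_eq_mul]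
  ring

theorem continuous_deriv_test {ψ : ℝ → ℝ} (h : ContDiff ℝ ∞ ψ) : Continuous (deriv ψ) :=
  h.continuous_deriv (by simp)

theorem IsWeakDeriv.add {f g f' g' : L2R} (hf : IsWeakDeriv f f') (hg : IsWeakDeriv g g') :
    IsWeakDeriv (f + g) (f' + g') := by
  intro ψ h hc
  rw [integral_testFunction_mul_add (continuous_deriv_test h) hc.deriv,
    integral_testFunction_mul_add h.continuous hc, hf ψ h hc, hg ψ h hc]
  ring

theorem IsWeakDeriv.smul {f f' : L2R} (c : ℂ) (hf : IsWeakDeriv f f') :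
    IsWeakDeriv (c • f) (c • f') := by
  intro ψ h hc
  rw [integral_testFunction_mul_smul, integral_testFunction_mul_smul, hf ψ h hc]
  ring

theorem IsWeakDeriv.zero : IsWeakDeriv 0 0 := by
  intro ψ h hc
  have h0 := integral_testFunction_mul_smul (deriv ψ) 0 0
  have h1 := integral_testFunction_mul_smul ψ 0 0
  rw [zero_smul, zero_mul] at h0 h1
  rw [h0, h1, neg_zero]

/-- The Sobolev space `H²(ℝ)`: the triples `(f, f', f'')` in `L₂(ℝ)` of a function and its first two
weak derivatives, with the norm `‖f‖² + ‖f'‖² + ‖f''‖²`, which is equivalent to the one given by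
the Fourier transform. -/
def H2 : Submodule ℂ (PiLp 2 fun _ : Fin 3 => L2R) where
  carrier := {w | IsWeakDeriv (w 0) (w 1) ∧ IsWeakDeriv (w 1) (w 2)}
  add_mem' := fun ha hb => ⟨ha.1.add hb.1, ha.2.add hb.2⟩
  zero_mem' := ⟨IsWeakDeriv.zero, IsWeakDeriv.zero⟩
  smul_mem' := fun c _ ha => ⟨ha.1.smul c, ha.2.smul c⟩

theorem continuous_integral_testFunction_mul {ψ : ℝ → ℝ} (h : Continuous ψ)
    (hc : HasCompactSupport ψ) : Continuous fun f : L2R => ∫ x, ((ψ x : ℝ) : ℂ) * f x := by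
  have key : (fun f : L2R => ∫ x, ((ψ x : ℝ) : ℂ) * f x) =
      fun f : L2R => inner ℂ (memLp_of_testFunction h hc).toLp f := by
    funext f
    rw [L2.inner_def]
    refine integral_congr_ae ?_
    filter_upwards [(memLp_of_testFunction h hc).coeFn_toLp] with x hx
    simp [hx, mul_comm]
  rw [key]
  exact continuous_const.inner continuous_id

theorem isClosed_isWeakDeriv : IsClosed {p : L2R × L2R | IsWeakDeriv p.1 p.2} := by
  simp only [IsWeakDeriv, ofPred_forall]
  refine isClosed_iInter fun ψ => isClosed_iInter fun h => isClosed_iInter fun hc => ?_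
  exact isClosed_eq
    ((continuous_integral_testFunction_mul (continuous_deriv_test h) hc.deriv).comp continuous_fst)
    ((continuous_integral_testFunction_mul h.continuous hc).comp continuous_snd).neg

instance : CompleteSpace H2 := by
  have h : IsClosed (H2 : Set (PiLp 2 fun _ : Fin 3 => L2R)) := by
    have h1 := isClosed_isWeakDeriv.preimage
      (((PiLp.continuous_apply 2 (fun _ : Fin 3 => L2R) 0)).prodMk
        (PiLp.continuous_apply 2 (fun _ : Fin 3 => L2R) 1))
    have h2 := isClosed_isWeakDeriv.preimage
      (((PiLp.continuous_apply 2 (fun _ : Fin 3 => L2R) 1)).prodMk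
        (PiLp.continuous_apply 2 (fun _ : Fin 3 => L2R) 2))
    exact h1.inter h2
  exact h.completeSpace_coe

/-- The function underlying an element of `H²(ℝ)`. -/
def H2.fn (w : H2) : L2R := w.1 0

/-- Its first weak derivative. -/
def H2.dx (w : H2) : L2R := w.1 1

/-- Its second weak derivative. -/
def H2.dxx (w : H2) : L2R := w.1 2

/-- `L₂((0,T);H²(ℝ))`. -/
abbrev L2H2 (T : ℝ) := Lp H2 2 (volume.restrict (Ioo (0 : ℝ) T))

open Classical in
/-- The pointwise product `f g` as an element of `L₂(ℝ)`. It is used only for `f = w` and `g = w_x`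
with `w ∈ H²(ℝ)`; then `f` is bounded, so that `f g` is in `L₂(ℝ)`. -/
def mulL2 (f g : L2R) : L2R :=
  if h : MemLp (fun x => f x * g x) 2 volume then h.toLp else 0

/-- A smooth compactly supported real function as an element of `L₂(ℝ)`. -/
def testToL2 (φ : ℝ → ℝ) (hφ : ContDiff ℝ ∞ φ) (hc : HasCompactSupport φ) : L2R :=
  (memLp_of_testFunction hφ.continuous hc).toLp

/-! ### The Wick Burgers equation -/

/-- `u` is a strong chaos solution of `u_t + u ⋄ u_x = u_xx` on `(0,T] × ℝ` with `u(0,·) = u₀`: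
it is an element of `(S)_{-1}(L₂((0,T);H²(ℝ)))`, and for all `z` in some neighborhood `K_ℓ(R)` of
zero, `u~ = u~(·;z)` satisfies, in `L₂(ℝ)` and for all `t ∈ [0,T]`,
`u~(t) + ∫₀ᵗ u~ u~_x ds = u₀~ + ∫₀ᵗ u~_xx ds`.
As `u~` is an equivalence class of functions of time, its values at all `t ∈ [0,T]` are those of a
version `U`. -/
structure IsStrongChaosSolution {ι : Type*} (q : ι → ℝ) (T : ℝ) (u₀ : MIdx ι → L2R)
    (u : MIdx ι → L2H2 T) : Prop where
  mem : MemKondratiev q u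
  eqn : ∃ R ℓ : ℝ, 0 < R ∧ 0 < ℓ ∧ ∀ z ∈ nbhd q ℓ R, ∃ U : ℝ → L2R,
    (∀ᵐ t ∂(volume.restrict (Ioo (0 : ℝ) T)), U t = H2.fn (sTransform u z t)) ∧
    ∀ t ∈ Icc (0 : ℝ) T,
      U t + ∫ s in (0 : ℝ)..t, mulL2 (H2.fn (sTransform u z s)) (H2.dx (sTransform u z s)) =
        sTransform u₀ z + ∫ s in (0 : ℝ)..t, H2.dxx (sTransform u z s)

end WickBurgers

end

/-! Membership in `(S)_{-ρ,-ℓ}` with `ρ < 1` makes the S-transform entire along each coordinate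
axis. Suppose a solution lies there, and let `V ζ` be its S-transform at `z = ζ e_k`. For small `ζ`,
`V ζ` solves the deterministic Burgers equation with initial value `ζ φ`.

Let `Φ` be the antiderivative of `φ` vanishing at `0`. The potential `W`, with `W_x = V ζ`,
satisfies `W_t = W_xx - W_x²/2`, so `exp(-W/2)` solves the heat equation (Cole–Hopf). At time `T`
and `x = 0` this gives `exp(-W(T,0)/2) = 𝔼 exp(-ζ Φ(Y)/2)` with `Y ~ N(0, 2T)` (`ColeHopf.formula`,
`ColeHopf.complexMGF_eq`). Here `W(T,0)` is the integral over `(0,T)` of `V_x(s,0) - V(s,0)²/2`, a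
continuous quadratic expression in `V ζ`, hence entire in `ζ` (`differentiable_pot`).

So near zero the moment generating function of the bounded variable `Φ(Y)` is the exponential of an
entire function, and by the identity theorem it is so everywhere. It grows at most exponentially, so
the exponent is affine (`Differentiable.eq_affine_of_re_le`). Then `𝔼 exp(Φ(Y)) · 𝔼 exp(-Φ(Y)) = 1`,
the equality case of Cauchy–Schwarz, which forces `Φ` to be constant (`eq_of_complexMGF_eq_exp`).
Hence `φ = Φ' = 0`, a contradiction. -/

/-! ### Absolutely continuous functions and the fundamental theorem of calculus -/

open Filter Topology in
theorem AbsolutelyContinuousOnInterval.of_dist_le {X Y : Type*} [PseudoMetricSpace X]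
    [PseudoMetricSpace Y] {f : ℝ → X} {G : ℝ → Y} {a b C : ℝ}
    (hG : AbsolutelyContinuousOnInterval G a b)
    (h : ∀ x ∈ uIcc a b, ∀ y ∈ uIcc a b, dist (f x) (f y) ≤ C * dist (G x) (G y)) :
    AbsolutelyContinuousOnInterval f a b := by
  have hG' := Tendsto.const_mul C hG
  rw [mul_zero] at hG'
  refine squeeze_zero' ?_ ?_ hG'
  · exact Eventually.of_forall fun E => Finset.sum_nonneg fun _ _ => dist_nonneg
  · have : ∀ᶠ E in AbsolutelyContinuousOnInterval.totalLengthFilter ⊓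
        𝓟 (AbsolutelyContinuousOnInterval.disjWithin a b),
        E ∈ AbsolutelyContinuousOnInterval.disjWithin a b :=
      eventually_inf_principal.mpr (by simp)
    filter_upwards [this] with E hE
    rw [Finset.mul_sum]
    exact Finset.sum_le_sum fun i hi => h _ (hE.1 i hi).1 _ (hE.1 i hi).2

theorem integral_sub_of_mem_uIcc {E : Type*} [NormedAddCommGroup E] [NormedSpace ℝ E]
    {q : ℝ → E} {a b x y : ℝ} (hq : IntervalIntegrable q volume a b) (hx : x ∈ uIcc a b)
    (hy : y ∈ uIcc a b) : (∫ r in a..y, q r) - ∫ r in a..x, q r = ∫ r in x..y, q r :=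
  intervalIntegral.integral_interval_sub_left
    (hq.mono_set (uIcc_subset_uIcc left_mem_uIcc hy))
    (hq.mono_set (uIcc_subset_uIcc left_mem_uIcc hx))

/-- The fundamental theorem of calculus for a vector-valued function whose increments are
controlled by those of an indefinite integral. -/
theorem integral_eq_sub_of_ae_hasDerivAt_of_dist_le {F : Type*} [NormedAddCommGroup F]
    [NormedSpace ℝ F] [CompleteSpace F] {f p : ℝ → F} {N : ℝ → ℝ} {a b : ℝ}
    (hp : IntervalIntegrable p volume a b) (hN : IntervalIntegrable N volume a b)
    (h : ∀ x ∈ uIcc a b, ∀ y ∈ uIcc a b, dist (f x) (f y) ≤ |∫ r in x..y, N r|)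
    (hd : ∀ᵐ x, x ∈ uIcc a b → HasDerivAt f (p x) x) :
    ∫ x in a..b, p x = f b - f a := by
  have hNc := hN.absolutelyContinuousOnInterval_intervalIntegral (c := a) left_mem_uIcc
  have hf : AbsolutelyContinuousOnInterval f a b := by
    refine hNc.of_dist_le (C := 1) fun x hx y hy => ?_
    rw [one_mul, dist_comm (∫ r in a..x, N r), Real.dist_eq, integral_sub_of_mem_uIcc hN hx hy]
    exact h x hx y hy
  have hpc : AbsolutelyContinuousOnInterval (fun x => ∫ r in a..x, p r) a b := by
    refine (hp.norm.absolutelyContinuousOnInterval_intervalIntegral (c := a)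
      left_mem_uIcc).of_dist_le (C := 1) fun x hx y hy => ?_
    rw [one_mul, dist_comm, dist_comm (∫ r in a..x, ‖p r‖), Real.dist_eq, dist_eq_norm,
      integral_sub_of_mem_uIcc hp hx hy, integral_sub_of_mem_uIcc hp.norm hx hy]
    exact intervalIntegral.norm_integral_le_abs_integral_norm
  -- Both `f` and the indefinite integral of `p` are absolutely continuous with derivative `p`
  -- almost everywhere, so their difference is constant.
  obtain ⟨c, hc⟩ := (hf.sub hpc).const_of_ae_hasDerivAt_zero (by
    filter_upwards [hd, hp.ae_hasDerivAt_integral] with x h1 h2 hx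
    simpa using (h1 hx).sub (h2 hx a left_mem_uIcc))
  have ha := hc a left_mem_uIcc
  have hb := hc b right_mem_uIcc
  simp only [Pi.sub_apply, intervalIntegral.integral_same, sub_zero] at ha hb
  rw [ha, ← hb]
  abel

/-- The exponential of an indefinite integral solves the corresponding linear equation. -/
theorem integral_mul_exp_integral {p : ℝ → ℂ} {b : ℝ} (w : ℂ)
    (hp : IntervalIntegrable p volume 0 b) :
    ∫ s in (0 : ℝ)..b, p s * Complex.exp (w + ∫ r in (0 : ℝ)..s, p r) =
      Complex.exp (w + ∫ r in (0 : ℝ)..b, p r) - Complex.exp w := by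
  have hcont : ContinuousOn (fun s => w + ∫ r in (0 : ℝ)..s, p r) (uIcc 0 b) :=
    continuousOn_const.add (intervalIntegral.continuousOn_primitive_interval' hp left_mem_uIcc)
  obtain ⟨M, hM⟩ := isCompact_uIcc.exists_bound_of_continuousOn hcont
  have hM' : ∀ s ∈ uIcc 0 b, (w + ∫ r in (0 : ℝ)..s, p r) ∈ Metric.closedBall (0 : ℂ) M :=
    fun s hs => by simpa using hM s hs
  -- The exponent has compact range, and on a ball containing it `exp` is Lipschitz; this bounds the
  -- increments of the exponential by those of an integral.
  have hlip : ∀ x ∈ Metric.closedBall (0 : ℂ) M, ∀ y ∈ Metric.closedBall (0 : ℂ) M,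
      ‖Complex.exp y - Complex.exp x‖ ≤ Real.exp M * ‖y - x‖ := by
    intro x hx y hy
    refine (convex_closedBall (0 : ℂ) M).norm_image_sub_le_of_norm_hasDerivWithin_le
      (f' := Complex.exp) (fun z _ => (Complex.hasDerivAt_exp z).hasDerivWithinAt)
      (fun z hz => ?_) hx hy
    rw [Complex.norm_exp]
    exact Real.exp_le_exp.2 ((Complex.re_le_norm z).trans (by simpa using hz))
  have key := integral_eq_sub_of_ae_hasDerivAt_of_dist_le
    (f := fun s => Complex.exp (w + ∫ r in (0 : ℝ)..s, p r))
    (p := fun s => p s * Complex.exp (w + ∫ r in (0 : ℝ)..s, p r))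
    (N := fun s => Real.exp M * ‖p s‖) (a := 0) (b := b)
    (hp.mul_continuousOn (Complex.continuous_exp.comp_continuousOn hcont))
    (hp.norm.const_mul _) ?_ ?_
  · simpa using key
  · intro x hx y hy
    rw [dist_comm, dist_eq_norm]
    refine (hlip _ (hM' x hx) _ (hM' y hy)).trans ?_
    rw [intervalIntegral.integral_const_mul, abs_mul, abs_of_pos (Real.exp_pos M),
      add_sub_add_left_eq_sub, integral_sub_of_mem_uIcc hp hx hy]
    gcongr
    exact intervalIntegral.norm_integral_le_abs_integral_norm
  · filter_upwards [hp.ae_hasDerivAt_integral] with x hx hxb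
    have := ((hx hxb 0 left_mem_uIcc).const_add w).cexp
    rwa [mul_comm] at this

/-! ### Entire exponents and moment generating functions -/

open Metric in
/-- An entire function whose real part grows at most linearly is affine. -/
theorem Differentiable.eq_affine_of_re_le {f : ℂ → ℂ} (hf : Differentiable ℂ f) {M B : ℝ}
    (hM : 0 ≤ M) (h : ∀ z, (f z).re ≤ M * ‖z‖ + B) : ∃ b : ℂ, ∀ z, f z = f 0 + b * z := by
  -- Absorbs the passage from `f` to `f - f 0`; the summand `1` supplies the strict positivity and
  -- strict bound required by Borel–Carathéodory.
  set B' : ℝ := |B| + ‖f 0‖ + 1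
  have hB' : 0 < B' := by positivity
  have h1 : ∀ z, ‖f z - f 0‖ ≤ (4 * M + 2 * B') * (1 + ‖z‖) := by
    intro z
    have hR : 0 < 2 * ‖z‖ + 1 := by positivity
    -- The radius `2‖z‖ + 1` exceeds `‖z‖` by `‖z‖ + 1`, so the quotient in the estimate stays of
    -- linear growth.
    have := Complex.borelCaratheodory_zero (f := fun z => f z - f 0) (M := M * (2 * ‖z‖ + 1) + B')
      (R := 2 * ‖z‖ + 1) (z := z) (by positivity) (by fun_prop) ?_ hR ?_ (by simp)
    · refine this.trans ?_
      rw [div_le_iff₀ (by linarith [norm_nonneg z])]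
      have := norm_nonneg z
      nlinarith [mul_nonneg hM this, mul_nonneg (mul_nonneg hM this) this,
        mul_nonneg hB'.le this, mul_nonneg (mul_nonneg hB'.le this) this]
    · intro x hx
      simp only [mem_ball_zero_iff] at hx
      simp only [mem_ofPred_eq, Complex.sub_re]
      have h2 := h x
      have h3 := Complex.abs_re_le_norm (f 0)
      have h4 := neg_abs_le (f 0).re
      have h5 := le_abs_self B
      have h6 := mul_le_mul_of_nonneg_left hx.le hM
      simp only [B']
      linarith
    · simp only [mem_ball_zero_iff]
      linarith [norm_nonneg z]
  have h2 : ∀ z, ‖_root_.deriv f z‖ ≤ 2 * (4 * M + 2 * B') := by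
    intro z
    have hz := norm_nonneg z
    -- Cauchy's estimate on a circle of radius comparable to `1 + ‖z‖` cancels the linear growth;
    -- Liouville's theorem then applies to the derivative.
    have := Complex.norm_deriv_le_of_forall_mem_sphere_norm_le (f := fun z => f z - f 0) (c := z)
      (R := 1 + ‖z‖) (C := (4 * M + 2 * B') * (2 + 2 * ‖z‖)) (by positivity)
      ((hf.sub_const _).diffContOnCl) ?_
    · rw [deriv_sub_const] at this
      refine this.trans (le_of_eq ?_)
      field_simp
    · intro w hw
      refine (h1 w).trans ?_
      have : ‖w‖ ≤ 1 + 2 * ‖z‖ := by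
        have h3 : ‖w - z‖ = 1 + ‖z‖ := by simpa [dist_eq_norm] using hw
        have := norm_le_norm_add_norm_sub' w z
        linarith
      exact mul_le_mul_of_nonneg_left (by linarith) (by positivity)
  have hd : Differentiable ℂ (_root_.deriv f) := fun z =>
    (hf.analyticAt z).deriv.differentiableAt
  have hconst : ∀ z, _root_.deriv f z = _root_.deriv f 0 := fun z =>
    hd.apply_eq_apply_of_bounded (isBounded_iff_forall_norm_le.2
      ⟨_, by rintro _ ⟨z, rfl⟩; exact h2 z⟩) z 0
  refine ⟨_root_.deriv f 0, fun z => ?_⟩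
  have hg : Differentiable ℂ fun z => f z - _root_.deriv f 0 * z := by fun_prop
  have := is_const_of_deriv_eq_zero hg (fun x => by
    have := ((hf x).hasDerivAt.sub ((hasDerivAt_id x).const_mul (_root_.deriv f 0))).deriv
    rw [hconst x, mul_one, sub_self] at this
    exact this) z 0
  linear_combination this

open Filter Topology in
/-- If the moment generating function of a bounded continuous function agrees near zero with the
exponential of an entire function, then the function is constant. -/
theorem eq_of_complexMGF_eq_exp {γ : Measure ℝ} [IsProbabilityMeasure γ] [γ.IsOpenPosMeasure]
    {Φ : ℝ → ℝ} (hΦ : Continuous Φ) {M : ℝ} (hM : ∀ y, |Φ y| ≤ M) {c : ℂ → ℂ}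
    (hc : Differentiable ℂ c) (h : ∀ᶠ z in 𝓝 (0 : ℂ), complexMGF Φ γ z = Complex.exp (c z))
    (x y : ℝ) : Φ x = Φ y := by
  have hM0 : 0 ≤ M := (abs_nonneg _).trans (hM 0)
  have hint : ∀ t : ℝ, Integrable (fun y => Real.exp (t * Φ y)) γ := fun t =>
    Integrable.of_bound (by fun_prop) (Real.exp (|t| * M)) (Eventually.of_forall fun y => by
      rw [Real.norm_eq_abs, Real.abs_exp]
      refine Real.exp_le_exp.2 ((le_abs_self _).trans ?_)
      rw [abs_mul]
      gcongr
      exact hM y)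
  have hset : integrableExpSet Φ γ = univ := eq_univ_of_forall hint
  have hdiff : Differentiable ℂ (complexMGF Φ γ) := fun z =>
    (analyticAt_complexMGF (by simp [hset])).differentiableAt
  -- Boundedness of `Φ` makes the moment generating function entire, so the local identity extends
  -- to the whole plane.
  have heq : complexMGF Φ γ = fun z => Complex.exp (c z) :=
    AnalyticOnNhd.eq_of_eventuallyEq (z₀ := 0)
      (fun z _ => hdiff.analyticAt z) (fun z _ => hc.cexp.analyticAt z) h
  have hre : ∀ z, (c z).re ≤ M * ‖z‖ + 0 := by
    intro z
    rw [← Real.exp_le_exp, ← Complex.norm_exp, ← congrFun heq z, complexMGF]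
    refine (norm_integral_le_of_norm_le_const (C := Real.exp (M * ‖z‖ + 0))
      (Eventually.of_forall fun y => ?_)).trans (by simp)
    rw [Complex.norm_exp]
    refine Real.exp_le_exp.2 ?_
    rw [add_zero, Complex.re_mul_ofReal, mul_comm]
    refine (le_abs_self _).trans ?_
    rw [abs_mul]
    gcongr
    · exact hM y
    · exact Complex.abs_re_le_norm z
  obtain ⟨b, hb⟩ := hc.eq_affine_of_re_le hM0 hre
  have hm : ∀ t : ℝ, ((mgf Φ γ t : ℝ) : ℂ) = Complex.exp (c t) := fun t => by
    rw [← congrFun heq, complexMGF_ofReal]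
  -- For affine `c`, `c 1 + c (-1) = 2 c 0`, and `exp (c 0)` is the total mass `1`.
  have hprod : mgf Φ γ 1 * mgf Φ γ (-1) = 1 := by
    have h0 := hm 0
    rw [mgf_zero] at h0
    have h1 : ((mgf Φ γ 1 * mgf Φ γ (-1) : ℝ) : ℂ) = 1 := by
      push_cast
      rw [hm, hm, hb, hb (-1 : ℝ), ← Complex.exp_add]
      have : c 0 + b * (1 : ℝ) + (c 0 + b * ((-1 : ℝ) : ℂ)) = c 0 + c 0 := by push_cast; ring
      rw [this, Complex.exp_add]
      have h0' : Complex.exp (c 0) = 1 := by simpa using h0.symm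
      rw [h0', one_mul]
    exact_mod_cast h1
  set m := mgf Φ γ 1 with hmdef
  have hmpos : 0 < m := mgf_pos (hint 1)
  have hm1 : mgf Φ γ (-1) = m⁻¹ := eq_inv_of_mul_eq_one_right hprod
  have hzero : ∫ y, (Real.exp (Φ y) / m + m * Real.exp (-Φ y) - 2) ∂γ = 0 := by
    have i1 := (hint 1).div_const m
    have i2 := (hint (-1)).const_mul m
    simp only [one_mul, neg_one_mul] at i1 i2
    rw [integral_sub (f := fun y => Real.exp (Φ y) / m + m * Real.exp (-Φ y)) (i1.add i2)
      (integrable_const _), integral_add i1 i2, integral_div, integral_const_mul]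
    have e1 : ∫ y, Real.exp (Φ y) ∂γ = m := by simp [hmdef, mgf]
    have e2 : ∫ y, Real.exp (-Φ y) ∂γ = m⁻¹ := by rw [← hm1]; simp [mgf]
    rw [e1, e2]
    field_simp
    simp
    norm_num
  -- The integrand of mean zero is a nonnegative square expression, so it vanishes almost
  -- everywhere; continuity and the positivity of `γ` on open sets make it vanish everywhere.
  have hform : ∀ y, Real.exp (Φ y) / m + m * Real.exp (-Φ y) - 2 =
      (Real.exp (Φ y) - m) ^ 2 / (m * Real.exp (Φ y)) := by
    intro y
    rw [Real.exp_neg]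
    have := Real.exp_pos (Φ y)
    field_simp
    ring
  simp only [hform] at hzero
  have hcontf : Continuous fun y => (Real.exp (Φ y) - m) ^ 2 / (m * Real.exp (Φ y)) := by
    refine Continuous.div (by fun_prop) (by fun_prop) fun y => by positivity
  have hintf : Integrable (fun y => (Real.exp (Φ y) - m) ^ 2 / (m * Real.exp (Φ y))) γ := by
    have i1 := (hint 1).div_const m
    have i2 := (hint (-1)).const_mul m
    simp only [one_mul, neg_one_mul] at i1 i2
    exact ((i1.add i2).sub (integrable_const 2)).congr (Eventually.of_forall fun y => by
      simpa using hform y)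
  rw [integral_eq_zero_iff_of_nonneg (fun y => by positivity) hintf] at hzero
  have hall := Continuous.ae_eq_iff_eq γ hcontf continuous_const |>.1 hzero
  have hval : ∀ y, Real.exp (Φ y) = m := by
    intro y
    have : (Real.exp (Φ y) - m) ^ 2 / (m * Real.exp (Φ y)) = 0 := congrFun hall y
    have hpos := Real.exp_pos (Φ y)
    rw [div_eq_zero_iff] at this
    rcases this with h | h
    · linarith [pow_eq_zero_iff (two_ne_zero) |>.1 h]
    · exact absurd h (by positivity)
  exact Real.exp_injective ((hval x).trans (hval y).symm)

/-! ### Weak derivatives on the line -/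

/-- A test function with vanishing integral is the derivative of a test function. -/
theorem exists_deriv_eq_of_integral_eq_zero {η : ℝ → ℝ} (hη : ContDiff ℝ ∞ η)
    (hc : HasCompactSupport η) (h0 : ∫ x, η x = 0) :
    ∃ ψ : ℝ → ℝ, ContDiff ℝ ∞ ψ ∧ HasCompactSupport ψ ∧ deriv ψ = η := by
  obtain ⟨R, hR⟩ := hc.isBounded.subset_ball 0
  rw [Real.ball_eq_Ioo, zero_sub, zero_add] at hR
  have hsupp : ∀ x, x ∉ Ioo (-R) R → η x = 0 := fun x hx => by
    by_contra h
    exact hx (hR (subset_tsupport _ h))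
  have hd : ∀ x, HasDerivAt (fun x => ∫ r in (-R)..x, η r) (η x) x := fun x =>
    intervalIntegral.integral_hasDerivAt_right (hη.continuous.intervalIntegrable _ _)
      (hη.continuous.stronglyMeasurableAtFilter _ _) hη.continuous.continuousAt
  have hderiv : deriv (fun x => ∫ r in (-R)..x, η r) = η := funext fun x => (hd x).deriv
  refine ⟨fun x => ∫ r in (-R)..x, η r, ?_, ?_, hderiv⟩
  · rw [contDiff_infty_iff_deriv, hderiv]
    exact ⟨fun x => (hd x).differentiableAt, hη⟩
  · refine HasCompactSupport.of_support_subset_isCompact (K := Icc (-R) R) isCompact_Icc ?_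
    intro x hx
    by_contra hx'
    refine hx ?_
    rw [mem_Icc, not_and_or, not_le, not_le] at hx'
    rcases hx' with h | h
    · refine (intervalIntegral.integral_congr (g := fun _ => 0) fun r hr => ?_).trans (by simp)
      rw [uIcc_of_ge h.le] at hr
      exact hsupp r fun h' => absurd hr.2 (not_le.2 h'.1)
    -- To the right of the support the primitive equals the total integral, which is zero.
    · change ∫ r in (-R)..x, η r = 0
      rw [intervalIntegral.integral_eq_integral_of_support_subset, h0]
      intro r hr
      have : r ∈ Ioo (-R) R := by
        by_contra h'
        exact hr (hsupp r h')
      exact ⟨this.1, (this.2.trans h).le⟩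

/-- The du Bois-Reymond lemma: a locally integrable function with zero weak derivative is a.e.
constant. -/
theorem ae_eq_const_of_integral_deriv_mul_eq_zero {F : ℝ → ℂ} (hF : LocallyIntegrable F volume)
    (h : ∀ ψ : ℝ → ℝ, ContDiff ℝ ∞ ψ → HasCompactSupport ψ →
      ∫ x, ((deriv ψ x : ℝ) : ℂ) * F x = 0) : ∃ C : ℂ, ∀ᵐ x, F x = C := by
  let b : ContDiffBump (0 : ℝ) := ⟨1, 2, one_pos, one_lt_two⟩
  set η₀ : ℝ → ℝ := b.normed volume
  have hη₀ : ContDiff ℝ ∞ η₀ := b.contDiff_normed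
  have hη₀c : HasCompactSupport η₀ := b.hasCompactSupport_normed
  have hη₀1 : ∫ x, η₀ x = 1 := b.integral_normed
  refine ⟨∫ x, η₀ x • F x, ?_⟩
  set C := ∫ x, η₀ x • F x
  have key := ae_eq_zero_of_integral_contDiff_smul_eq_zero (f := fun x => F x - C) (μ := volume)
    (hF.sub (locallyIntegrable_const C)) ?_
  · filter_upwards [key] with x hx
    exact sub_eq_zero.1 hx
  · intro η hη hηc
    have hi := hη.continuous.integrable_of_hasCompactSupport hηc (μ := volume)
    have hi₀ := hη₀.continuous.integrable_of_hasCompactSupport hη₀c (μ := volume)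
    have hiF := hF.integrable_smul_left_of_hasCompactSupport hη.continuous hηc
    have hiF₀ := hF.integrable_smul_left_of_hasCompactSupport hη₀.continuous hη₀c
    -- Subtracting a multiple of the normalized bump makes the integral of `η` vanish; that multiple
    -- produces the constant `C`.
    obtain ⟨ψ, hψ, hψc, hψd⟩ := exists_deriv_eq_of_integral_eq_zero
      (η := fun x => η x - (∫ y, η y) * η₀ x) (hη.sub (contDiff_const.mul hη₀))
      (hηc.sub (hη₀c.mul_left)) (by
        rw [integral_sub hi (hi₀.const_mul _), integral_const_mul, hη₀1, mul_one, sub_self])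
    have h1 := h ψ hψ hψc
    rw [hψd] at h1
    have h2 : ∀ x, (((η x - (∫ y, η y) * η₀ x : ℝ)) : ℂ) * F x =
        η x • F x - (∫ y, η y) • (η₀ x • F x) := fun x => by
      simp only [Complex.real_smul]
      push_cast
      ring
    simp only [h2] at h1
    rw [integral_sub hiF (g := fun x => (∫ y, η y) • (η₀ x • F x))
      (hiF₀.smul (∫ y, η y)), integral_smul] at h1
    simp only [smul_sub]
    rw [integral_sub hiF (hi.smul_const C), integral_smul_const]
    exact h1

/-- Integration by parts for a test function and an indefinite integral. -/
theorem integral_deriv_mul_integral {ψ : ℝ → ℝ} (hψ : ContDiff ℝ ∞ ψ) (hc : HasCompactSupport ψ)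
    {g : ℝ → ℂ} (hg : LocallyIntegrable g volume) :
    ∫ x, ((deriv ψ x : ℝ) : ℂ) * (∫ r in (0 : ℝ)..x, g r) = -∫ x, ((ψ x : ℝ) : ℂ) * g x := by
  have hgi : ∀ a b, IntervalIntegrable g volume a b := fun a b =>
    (hg.integrableOn_isCompact isCompact_uIcc).intervalIntegrable
  have hGc : Continuous fun x => ∫ r in (0 : ℝ)..x, g r :=
    intervalIntegral.continuous_primitive hgi 0
  have hψd : Continuous (deriv ψ) := hψ.continuous_deriv (by simp)
  obtain ⟨R, hR⟩ := hc.isBounded.subset_ball 0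
  rw [Real.ball_eq_Ioo, zero_sub, zero_add] at hR
  have hRI : Ioo (-R) R ⊆ Ioc (-R) R := Ioo_subset_Ioc_self
  have s1 : Function.support (fun x => ((deriv ψ x : ℝ) : ℂ) * (∫ r in (0 : ℝ)..x, g r)) ⊆
      Ioc (-R) R := fun x hx => hRI (hR (support_deriv_subset (fun h => hx (by simp [h]))))
  have s2 : Function.support (fun x => ((ψ x : ℝ) : ℂ) * g x) ⊆
      Ioc (-R) R := fun x hx => hRI (hR (subset_tsupport _ (fun h => hx (by simp [h]))))
  have i1 : IntervalIntegrable (fun x => ((deriv ψ x : ℝ) : ℂ) * (∫ r in (0 : ℝ)..x, g r))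
      volume (-R) R := ((Complex.continuous_ofReal.comp hψd).mul hGc).intervalIntegrable _ _
  have i2 : IntervalIntegrable (fun x => ((ψ x : ℝ) : ℂ) * g x) volume (-R) R :=
    (hgi _ _).continuousOn_mul (Complex.continuous_ofReal.comp hψ.continuous).continuousOn
  rw [← intervalIntegral.integral_eq_integral_of_support_subset s1,
    ← intervalIntegral.integral_eq_integral_of_support_subset s2, eq_neg_iff_add_eq_zero,
    ← intervalIntegral.integral_add i1 i2]
  obtain ⟨M₁, hM₁⟩ := hψ.continuous.bounded_above_of_compact_support hc
  obtain ⟨M₂, hM₂⟩ := (isCompact_uIcc (a := -R) (b := R)).exists_bound_of_continuousOn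
    hGc.continuousOn
  have hM₂0 : 0 ≤ M₂ := (norm_nonneg _).trans (hM₂ (-R) left_mem_uIcc)
  -- The product rule for increments, with `|ψ| ≤ M₁` and the primitive of `g` bounded by `M₂` on
  -- `[-R, R]`, yields the dominating density.
  have key := integral_eq_sub_of_ae_hasDerivAt_of_dist_le
    (f := fun x => ((ψ x : ℝ) : ℂ) * (∫ r in (0 : ℝ)..x, g r))
    (N := fun x => M₁ * ‖g x‖ + M₂ * ‖deriv ψ x‖) (i1.add i2)
    (((hgi _ _).norm.const_mul _).add ((hψd.norm.intervalIntegrable _ _).const_mul _)) ?_ ?_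
  · refine key.trans ?_
    have e1 : ψ R = 0 := image_eq_zero_of_notMem_tsupport fun h => by simpa using hR h
    have e2 : ψ (-R) = 0 := image_eq_zero_of_notMem_tsupport fun h => by simpa using hR h
    simp [e1, e2]
  · intro x hx y hy
    have hM₁0 : 0 ≤ M₁ := (norm_nonneg _).trans (hM₁ 0)
    have hsub : (∫ r in (0 : ℝ)..y, g r) - ∫ r in (0 : ℝ)..x, g r = ∫ r in x..y, g r :=
      intervalIntegral.integral_interval_sub_left (hgi _ _) (hgi _ _)
    have hψsub : ψ y - ψ x = ∫ r in x..y, deriv ψ r :=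
      (intervalIntegral.integral_deriv_eq_sub
        (fun r _ => hψ.differentiable (by simp) r) (hψd.intervalIntegrable _ _)).symm
    have e : ((ψ y : ℝ) : ℂ) * (∫ r in (0 : ℝ)..y, g r) - ((ψ x : ℝ) : ℂ) * (∫ r in (0 : ℝ)..x, g r)
        = ((ψ y : ℝ) : ℂ) * (∫ r in x..y, g r) +
          ((∫ r in x..y, deriv ψ r : ℝ) : ℂ) * (∫ r in (0 : ℝ)..x, g r) := by
      rw [← hsub, ← hψsub]
      push_cast
      ring
    rw [dist_comm, dist_eq_norm, e, intervalIntegral.integral_add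
      ((hgi _ _).norm.const_mul _) ((hψd.norm.intervalIntegrable _ _).const_mul _),
      intervalIntegral.integral_const_mul, intervalIntegral.integral_const_mul]
    refine (norm_add_le _ _).trans ?_
    rw [norm_mul, norm_mul, Complex.norm_real, Complex.norm_real]
    have b1 : ‖ψ y‖ * ‖∫ r in x..y, g r‖ ≤ M₁ * |∫ r in x..y, ‖g r‖| :=
      mul_le_mul (hM₁ y) intervalIntegral.norm_integral_le_abs_integral_norm (norm_nonneg _) hM₁0
    have b2 : ‖∫ r in x..y, deriv ψ r‖ * ‖∫ r in (0 : ℝ)..x, g r‖ ≤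
        M₂ * |∫ r in x..y, ‖deriv ψ r‖| := by
      rw [mul_comm]
      exact mul_le_mul (hM₂ x hx) intervalIntegral.norm_integral_le_abs_integral_norm
        (norm_nonneg _) hM₂0
    refine (add_le_add b1 b2).trans (le_of_eq ?_)
    rcases le_total x y with hxy | hxy
    · rw [abs_of_nonneg (intervalIntegral.integral_nonneg hxy fun _ _ => norm_nonneg _),
        abs_of_nonneg (intervalIntegral.integral_nonneg hxy fun _ _ => norm_nonneg _),
        abs_of_nonneg]
      exact add_nonneg
        (mul_nonneg hM₁0 (intervalIntegral.integral_nonneg hxy fun _ _ => norm_nonneg _))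
        (mul_nonneg hM₂0 (intervalIntegral.integral_nonneg hxy fun _ _ => norm_nonneg _))
    · rw [intervalIntegral.integral_symm y x, intervalIntegral.integral_symm (μ := volume)
        (f := fun r => ‖deriv ψ r‖) y x, abs_neg, abs_neg, mul_neg, mul_neg, ← neg_add, abs_neg,
        abs_of_nonneg (intervalIntegral.integral_nonneg hxy fun _ _ => norm_nonneg _),
        abs_of_nonneg (intervalIntegral.integral_nonneg hxy fun _ _ => norm_nonneg _),
        abs_of_nonneg]
      exact add_nonneg
        (mul_nonneg hM₁0 (intervalIntegral.integral_nonneg hxy fun _ _ => norm_nonneg _))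
        (mul_nonneg hM₂0 (intervalIntegral.integral_nonneg hxy fun _ _ => norm_nonneg _))
  · filter_upwards [LocallyIntegrable.ae_hasDerivAt_integral hg] with x hx _
    exact ((hψ.differentiable (by simp) x).hasDerivAt.ofReal_comp).mul (hx 0)

/-! ### Continuous representatives, products and evaluations on `H²(ℝ)` -/

namespace WickBurgers

noncomputable section

theorem locallyIntegrable_L2R (f : L2R) : LocallyIntegrable f volume :=
  (Lp.memLp f).locallyIntegrable (by norm_num)

theorem intervalIntegrable_L2R (f : L2R) (a b : ℝ) : IntervalIntegrable f volume a b :=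
  ((locallyIntegrable_L2R f).integrableOn_isCompact isCompact_uIcc).intervalIntegrable

theorem continuous_primitive_L2R (f : L2R) (a : ℝ) : Continuous fun x => ∫ r in a..x, f r :=
  intervalIntegral.continuous_primitive (intervalIntegrable_L2R f) a

/-- A function with a weak derivative is a.e. an indefinite integral of the latter. -/
theorem IsWeakDeriv.exists_ae_eq {f g : L2R} (h : IsWeakDeriv f g) :
    ∃ C : ℂ, ∀ᵐ x, f x = C + ∫ r in (0 : ℝ)..x, g r := by
  have hG := continuous_primitive_L2R g 0
  obtain ⟨C, hC⟩ := ae_eq_const_of_integral_deriv_mul_eq_zero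
    (F := fun x => f x - ∫ r in (0 : ℝ)..x, g r)
    ((locallyIntegrable_L2R f).sub hG.locallyIntegrable) fun ψ hψ hc => by
      have hd := continuous_deriv_test hψ
      simp only [mul_sub]
      rw [integral_sub (integrable_testFunction_mul hd hc.deriv f), h ψ hψ hc,
        integral_deriv_mul_integral hψ hc (locallyIntegrable_L2R g), sub_self]
      exact hG.locallyIntegrable.integrable_smul_left_of_hasCompactSupport (g := fun x =>
        ((deriv ψ x : ℝ) : ℂ)) (Complex.continuous_ofReal.comp hd)
        (hc.deriv.comp_left (g := fun r : ℝ => (r : ℂ)) Complex.ofReal_zero)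
  refine ⟨C, ?_⟩
  filter_upwards [hC] with x hx
  rw [← hx]
  ring

/-- The functional `f ↦ ∫ₐᵇ f`. -/
def intervalFunctional (a b : ℝ) : L2R →L[ℂ] ℂ :=
  -- At least one of the two half-open intervals is empty; the difference gives the oriented
  -- integral for either order of the endpoints.
  innerSL ℂ (indicatorConstLp 2 measurableSet_Ioc (measure_Ioc_lt_top (a := a) (b := b)).ne 1) -
    innerSL ℂ (indicatorConstLp 2 measurableSet_Ioc (measure_Ioc_lt_top (a := b) (b := a)).ne 1)

theorem intervalFunctional_apply (a b : ℝ) (f : L2R) :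
    intervalFunctional a b f = ∫ x in a..b, f x := by
  rw [intervalFunctional, sub_apply, innerSL_apply_apply, innerSL_apply_apply,
    L2.inner_indicatorConstLp_one, L2.inner_indicatorConstLp_one, intervalIntegral]

/-- Cauchy–Schwarz against the indicator of an interval of length at most one. -/
theorem norm_integral_le_of_mem_Icc {x y : ℝ} (hy : y ∈ Icc x (x + 1)) (f : L2R) :
    ‖∫ r in x..y, f r‖ ≤ ‖f‖ := by
  rw [intervalIntegral.integral_of_le hy.1, ← L2.inner_indicatorConstLp_one (𝕜 := ℂ)
    measurableSet_Ioc measure_Ioc_lt_top.ne]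
  refine (norm_inner_le_norm _ _).trans (mul_le_of_le_one_left (norm_nonneg _) ?_)
  rw [norm_indicatorConstLp (by simp) (by simp)]
  simp only [norm_one, one_mul, Measure.real, Real.volume_Ioc]
  refine Real.rpow_le_one ENNReal.toReal_nonneg ?_ (by positivity)
  rw [ENNReal.toReal_ofReal (by linarith [hy.1])]
  linarith [hy.2]

/-- The functional `g ↦ ∫₀¹ ∫₀ʸ g`. -/
def doubleIntegral : L2R →L[ℂ] ℂ :=
  LinearMap.mkContinuous
    { toFun := fun g => ∫ y in (0 : ℝ)..1, ∫ r in (0 : ℝ)..y, g r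
      map_add' := fun g g' => by
        rw [← intervalIntegral.integral_add ((continuous_primitive_L2R g 0).intervalIntegrable _ _)
          ((continuous_primitive_L2R g' 0).intervalIntegrable _ _)]
        simp only [← intervalFunctional_apply, map_add]
      map_smul' := fun c g => by
        simp only [← intervalFunctional_apply, map_smul, RingHom.id_apply, smul_eq_mul,
          intervalIntegral.integral_const_mul] } 1 fun g => by
    have := intervalIntegral.norm_integral_le_of_norm_le_const (a := 0) (b := 1) (C := ‖g‖)
      (f := fun y => ∫ r in (0 : ℝ)..y, g r) fun y hy => by
        rw [uIoc_of_le zero_le_one] at hy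
        exact norm_integral_le_of_mem_Icc ⟨hy.1.le, by linarith [hy.2]⟩ g
    simpa using this

/-- The value at zero of the continuous representative of `f`, in terms of `f` and its weak
derivative `g`. -/
def valueZero (f g : L2R) : ℂ := intervalFunctional 0 1 f - doubleIntegral g

/-- The continuous representative of `f` with weak derivative `g`. -/
def contRep (f g : L2R) (x : ℝ) : ℂ := valueZero f g + ∫ r in (0 : ℝ)..x, g r

theorem contRep_zero (f g : L2R) : contRep f g 0 = valueZero f g := by simp [contRep]

theorem continuous_contRep (f g : L2R) : Continuous (contRep f g) :=
  continuous_const.add (continuous_primitive_L2R g 0)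

theorem contRep_sub (f g : L2R) (x y : ℝ) :
    contRep f g y - contRep f g x = ∫ r in x..y, g r := by
  rw [contRep, contRep, add_sub_add_left_eq_sub, intervalIntegral.integral_interval_sub_left
    (intervalIntegrable_L2R g _ _) (intervalIntegrable_L2R g _ _)]

theorem IsWeakDeriv.ae_eq_contRep {f g : L2R} (h : IsWeakDeriv f g) : f =ᵐ[volume] contRep f g := by
  obtain ⟨C, hC⟩ := h.exists_ae_eq
  -- Averaging `f(y) = C + ∫₀ʸ g` over `[0,1]` recovers `C` by continuous linear functionals of `f`
  -- and `g`.
  have hv : valueZero f g = C := by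
    rw [valueZero, intervalFunctional_apply, intervalIntegral.integral_congr_ae
      (hC.mono fun x hx _ => hx), intervalIntegral.integral_add (by simp)
      ((continuous_primitive_L2R g 0).intervalIntegrable _ _)]
    simp [doubleIntegral]
  filter_upwards [hC] with x hx
  rw [hx, contRep, hv]

/-- The one-dimensional Sobolev bound: comparing the value at `x` with the mean over `[x, x+1]`
gives a constant independent of `x`. -/
theorem IsWeakDeriv.norm_contRep_le {f g : L2R} (h : IsWeakDeriv f g) (x : ℝ) :
    ‖contRep f g x‖ ≤ ‖f‖ + ‖g‖ := by
  have h1 : ∫ y in x..x + 1, f y = contRep f g x + ∫ y in x..x + 1, ∫ r in x..y, g r := by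
    rw [intervalIntegral.integral_congr_ae (h.ae_eq_contRep.mono fun y hy _ => hy)]
    have : ∀ y, contRep f g y = contRep f g x + ∫ r in x..y, g r := fun y => by
      rw [← contRep_sub]
      ring
    rw [intervalIntegral.integral_congr fun y _ => this y]
    rw [intervalIntegral.integral_add (by simp)
      ((continuous_primitive_L2R g x).intervalIntegrable _ _)]
    simp
  have h2 : contRep f g x = (∫ y in x..x + 1, f y) - ∫ y in x..x + 1, ∫ r in x..y, g r := by
    rw [h1, add_sub_cancel_right]
  rw [h2]
  refine (norm_sub_le _ _).trans (add_le_add (norm_integral_le_of_mem_Icc ⟨by simp, le_rfl⟩ f) ?_)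
  have := intervalIntegral.norm_integral_le_of_norm_le_const (a := x) (b := x + 1) (C := ‖g‖)
      (f := fun y => ∫ r in x..y, g r) fun y hy => by
        rw [uIoc_of_le (by linarith)] at hy
        exact norm_integral_le_of_mem_Icc ⟨hy.1.le, hy.2⟩ g
  simpa using this

theorem memLp_mul_of_norm_le {f g : L2R} {B : ℝ} (hf : ∀ᵐ x, ‖f x‖ ≤ B) :
    MemLp (fun x => f x * g x) 2 volume :=
  (Lp.memLp g).of_le_mul (c := B) ((Lp.aestronglyMeasurable f).mul (Lp.aestronglyMeasurable g)) (by
    filter_upwards [hf] with x hx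
    rw [norm_mul]
    gcongr)

/-- Boundedness of one factor rules out the default value `0` of `mulL2`. -/
theorem mulL2_ae {f g : L2R} {B : ℝ} (hf : ∀ᵐ x, ‖f x‖ ≤ B) :
    mulL2 f g =ᵐ[volume] fun x => f x * g x := by
  rw [mulL2, dif_pos (memLp_mul_of_norm_le hf)]
  exact MemLp.coeFn_toLp _

namespace H2

theorem norm_fn_le (w : H2) : ‖(fn w)‖ ≤ ‖w‖ := PiLp.norm_apply_le w.1 0

theorem norm_dx_le (w : H2) : ‖(dx w)‖ ≤ ‖w‖ := PiLp.norm_apply_le w.1 1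

theorem norm_dxx_le (w : H2) : ‖(dxx w)‖ ≤ ‖w‖ := PiLp.norm_apply_le w.1 2

/-- The continuous linear maps `w ↦ w`, `w ↦ w_x`, `w ↦ w_xx` from `H²` to `L₂`. -/
def comp (i : Fin 3) : H2 →L[ℂ] L2R := (PiLp.proj 2 (fun _ : Fin 3 => L2R) i).comp H2.subtypeL

/-- The continuous representative of `w ∈ H²`. -/
def rep (w : H2) : ℝ → ℂ := contRep (fn w) (dx w)

/-- The continuous representative of the derivative of `w ∈ H²`. -/
def repDx (w : H2) : ℝ → ℂ := contRep (dx w) (dxx w)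

theorem fn_ae (w : H2) : (fn w) =ᵐ[volume] (rep w) := w.2.1.ae_eq_contRep

theorem dx_ae (w : H2) : (dx w) =ᵐ[volume] (repDx w) := w.2.2.ae_eq_contRep

theorem continuous_rep (w : H2) : Continuous (rep w) := continuous_contRep _ _

theorem continuous_repDx (w : H2) : Continuous (repDx w) := continuous_contRep _ _

theorem norm_rep_le (w : H2) (x : ℝ) : ‖(rep w) x‖ ≤ 2 * ‖w‖ := by
  have h : ‖(rep w) x‖ ≤ ‖(fn w)‖ + ‖(dx w)‖ := IsWeakDeriv.norm_contRep_le w.2.1 x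
  linarith [(norm_fn_le w), (norm_dx_le w)]

theorem norm_repDx_le (w : H2) (x : ℝ) : ‖(repDx w) x‖ ≤ 2 * ‖w‖ := by
  have h : ‖(repDx w) x‖ ≤ ‖(dx w)‖ + ‖(dxx w)‖ := IsWeakDeriv.norm_contRep_le w.2.2 x
  linarith [(norm_dx_le w), (norm_dxx_le w)]

theorem hasDerivAt_rep (w : H2) (x : ℝ) : HasDerivAt (rep w) ((repDx w) x) x := by
  have h : (rep w) = fun y => (rep w) 0 + ∫ r in (0 : ℝ)..y, (repDx w) r := by
    funext y
    rw [← intervalIntegral.integral_congr_ae ((dx_ae w).mono fun r hr _ => hr),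
      ← contRep_sub (fn w)]
    simp [rep]
  rw [h]
  exact (intervalIntegral.integral_hasDerivAt_right ((continuous_repDx w).intervalIntegrable _ _)
    ((continuous_repDx w).stronglyMeasurableAtFilter _ _)
    (continuous_repDx w).continuousAt).const_add _

/-- Evaluation at zero, as a functional on `H²`. -/
def evalZero : H2 →L[ℂ] ℂ :=
  (intervalFunctional 0 1).comp (comp 0) - doubleIntegral.comp (comp 1)

/-- Evaluation of the derivative at zero, as a functional on `H²`. -/
def evalDxZero : H2 →L[ℂ] ℂ :=
  (intervalFunctional 0 1).comp (comp 1) - doubleIntegral.comp (comp 2)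

theorem evalZero_apply (w : H2) : evalZero w = (rep w) 0 := (contRep_zero _ _).symm

theorem evalDxZero_apply (w : H2) : evalDxZero w = (repDx w) 0 := (contRep_zero _ _).symm

theorem rep_eq (w : H2) (x : ℝ) :
    (rep w) x = evalZero w + intervalFunctional 0 x (comp 1 w) := by
  rw [intervalFunctional_apply]
  rfl

theorem repDx_eq (w : H2) (x : ℝ) :
    (repDx w) x = evalDxZero w + intervalFunctional 0 x (comp 2 w) := by
  rw [intervalFunctional_apply]
  rfl

theorem ae_norm_fn_le (w : H2) : ∀ᵐ x, ‖(fn w) x‖ ≤ 2 * ‖w‖ := by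
  filter_upwards [(fn_ae w)] with x hx
  rw [hx]
  exact (norm_rep_le w) x

theorem mulL2_fn_ae (w : H2) (g : L2R) : mulL2 (fn w) g =ᵐ[volume] fun x => (fn w) x * g x :=
  mulL2_ae (ae_norm_fn_le w)

theorem norm_mulL2_fn_le (w : H2) (g : L2R) : ‖mulL2 (fn w) g‖ ≤ 2 * ‖w‖ * ‖g‖ := by
  refine Lp.norm_le_mul_norm_of_ae_le_mul ?_
  filter_upwards [(mulL2_fn_ae w) g, (ae_norm_fn_le w)] with x hx hx'
  rw [hx, norm_mul]
  gcongr

/-- The bilinear map `(w, g) ↦ w g`. -/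
def mulBilin : H2 →L[ℂ] L2R →L[ℂ] L2R :=
  LinearMap.mkContinuous₂ (LinearMap.mk₂ ℂ (fun (w : H2) (g : L2R) => mulL2 (fn w) g)
    (fun w w' g => by
      refine Lp.ext ?_
      filter_upwards [(mulL2_fn_ae (w + w')) g, (mulL2_fn_ae w) g, (mulL2_fn_ae w') g,
        Lp.coeFn_add (mulL2 (fn w) g) (mulL2 (fn w') g), Lp.coeFn_add (fn w) (fn w')]
        with x h1 h2 h3 h4 h5
      have h6 : (fn (w + w')) = (fn w) + (fn w') := rfl
      rw [h1, h4, Pi.add_apply, h2, h3, h6, h5, Pi.add_apply, add_mul])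
    (fun c w g => by
      refine Lp.ext ?_
      filter_upwards [(mulL2_fn_ae (c • w)) g, (mulL2_fn_ae w) g,
        Lp.coeFn_smul c (mulL2 (fn w) g), Lp.coeFn_smul c (fn w)] with x h1 h2 h4 h5
      have h6 : (fn (c • w)) = c • (fn w) := rfl
      rw [h1, h4, Pi.smul_apply, h2, h6, h5, Pi.smul_apply, smul_mul_assoc])
    (fun w g g' => by
      refine Lp.ext ?_
      filter_upwards [(mulL2_fn_ae w) (g + g'), (mulL2_fn_ae w) g, (mulL2_fn_ae w) g',
        Lp.coeFn_add (mulL2 (fn w) g) (mulL2 (fn w) g'), Lp.coeFn_add g g'] with x h1 h2 h3 h4 h5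
      rw [h1, h4, Pi.add_apply, h2, h3, h5, Pi.add_apply, mul_add])
    (fun c w g => by
      refine Lp.ext ?_
      filter_upwards [(mulL2_fn_ae w) (c • g), (mulL2_fn_ae w) g,
        Lp.coeFn_smul c (mulL2 (fn w) g), Lp.coeFn_smul c g] with x h1 h2 h4 h5
      rw [h1, h4, Pi.smul_apply, h2, h5, Pi.smul_apply, mul_smul_comm]))
    2 fun w g => (norm_mulL2_fn_le w) g

/-- Supplies the measurability in time of `w w_x`, needed for its Bochner integrability. -/
theorem continuous_mulL2 : Continuous fun w : H2 => mulL2 (fn w) (dx w) :=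
  (mulBilin.continuous.comp continuous_id).clm_apply (comp 1).continuous

theorem norm_mulL2_le (w : H2) : ‖mulL2 (fn w) (dx w)‖ ≤ 2 * ‖w‖ ^ 2 := by
  refine ((norm_mulL2_fn_le w) (dx w)).trans ?_
  rw [pow_two, ← mul_assoc]
  gcongr
  exact (norm_dx_le w)

/-- The nonlinearity is conservative: `w w_x = (w²/2)_x`. -/
theorem intervalFunctional_mulL2 (w : H2) (y : ℝ) :
    intervalFunctional 0 y (mulL2 (fn w) (dx w)) = ((rep w) y ^ 2 - (rep w) 0 ^ 2) / 2 := by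
  have h : ∀ x, HasDerivAt (fun x => (rep w) x ^ 2 / 2) ((rep w) x * (repDx w) x) x := fun x => by
    have := (((hasDerivAt_rep w) x).pow 2).div_const 2
    refine this.congr_deriv ?_
    simp
    ring
  rw [intervalFunctional_apply, intervalIntegral.integral_congr_ae
    (g := fun x => (rep w) x * (repDx w) x), intervalIntegral.integral_eq_sub_of_hasDerivAt
    (fun x _ => h x) (((continuous_rep w).mul (continuous_repDx w)).intervalIntegrable _ _)]
  · ring
  · filter_upwards [(mulL2_fn_ae w) (dx w), (fn_ae w), (dx_ae w)] with x h1 h2 h3 _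
    rw [h1, h2, h3]

theorem intervalFunctional_dxx (w : H2) (y : ℝ) :
    intervalFunctional 0 y (dxx w) = (repDx w) y - (repDx w) 0 := by
  rw [intervalFunctional_apply, ← contRep_sub (dx w)]
  rfl

theorem intervalFunctional_fn (w : H2) (y : ℝ) :
    intervalFunctional 0 y (fn w) = ∫ x in (0 : ℝ)..y, (rep w) x := by
  rw [intervalFunctional_apply]
  exact intervalIntegral.integral_congr_ae ((fn_ae w).mono fun x hx _ => hx)

/-- A function measurable in time and continuous in space is jointly measurable; at fixed `x` the
value is a continuous functional on `H²`. -/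
theorem stronglyMeasurable_rep {v : ℝ → H2} (hv : StronglyMeasurable v) :
    StronglyMeasurable fun p : ℝ × ℝ => rep (v p.1) p.2 := by
  have h1 : ∀ x, StronglyMeasurable fun s => rep (v s) x := fun x => by
    have h2 : StronglyMeasurable fun s => evalZero (v s) :=
      evalZero.continuous.comp_stronglyMeasurable hv
    have h3 : StronglyMeasurable fun s => comp 1 (v s) :=
      (comp 1).continuous.comp_stronglyMeasurable hv
    have h4 : StronglyMeasurable fun s => intervalFunctional 0 x (comp 1 (v s)) :=
      (intervalFunctional 0 x).continuous.comp_stronglyMeasurable h3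
    simp only [rep_eq]
    exact h2.add h4
  have h : StronglyMeasurable (Function.uncurry fun (x s : ℝ) => rep (v s) x) :=
    stronglyMeasurable_uncurry_of_continuous_of_stronglyMeasurable
      (fun s => continuous_rep (v s)) h1
  have h5 : (fun p : ℝ × ℝ => rep (v p.1) p.2) =
      (Function.uncurry fun (x s : ℝ) => rep (v s) x) ∘ Prod.swap := rfl
  rw [h5]
  exact h.comp_measurable measurable_swap

theorem stronglyMeasurable_repDx {v : ℝ → H2} (hv : StronglyMeasurable v) :
    StronglyMeasurable fun p : ℝ × ℝ => repDx (v p.1) p.2 := by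
  have h1 : ∀ x, StronglyMeasurable fun s => repDx (v s) x := fun x => by
    have h2 : StronglyMeasurable fun s => evalDxZero (v s) :=
      evalDxZero.continuous.comp_stronglyMeasurable hv
    have h3 : StronglyMeasurable fun s => comp 2 (v s) :=
      (comp 2).continuous.comp_stronglyMeasurable hv
    have h4 : StronglyMeasurable fun s => intervalFunctional 0 x (comp 2 (v s)) :=
      (intervalFunctional 0 x).continuous.comp_stronglyMeasurable h3
    simp only [repDx_eq]
    exact h2.add h4
  have h : StronglyMeasurable (Function.uncurry fun (x s : ℝ) => repDx (v s) x) :=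
    stronglyMeasurable_uncurry_of_continuous_of_stronglyMeasurable
      (fun s => continuous_repDx (v s)) h1
  have h5 : (fun p : ℝ × ℝ => repDx (v p.1) p.2) =
      (Function.uncurry fun (x s : ℝ) => repDx (v s) x) ∘ Prod.swap := rfl
  rw [h5]
  exact h.comp_measurable measurable_swap

end H2

end

end WickBurgers

/-! ### The heat kernel and the Cole–Hopf formula -/

namespace WickBurgers

noncomputable section

/-- The logarithm of `(4π)^{1/2}` times the heat kernel. -/
def logHeat (r y : ℝ) : ℝ := -(Real.log r / 2) - y ^ 2 / (4 * r)

theorem hasDerivAt_logHeat_time {τ s : ℝ} (h : s < τ) (y : ℝ) :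
    HasDerivAt (fun s => logHeat (τ - s) y)
      (1 / (2 * (τ - s)) - y ^ 2 / (4 * (τ - s) ^ 2)) s := by
  have hr : τ - s ≠ 0 := by linarith
  have h1 : HasDerivAt (fun s => τ - s) (-1) s := by simpa using (hasDerivAt_id s).const_sub τ
  have h2 := ((h1.log hr).div_const 2).neg.sub
    ((hasDerivAt_const s (y ^ 2)).div (h1.const_mul 4) (by simpa using hr))
  refine h2.congr_deriv ?_
  field_simp
  ring

theorem hasDerivAt_logHeat_space (r y : ℝ) :
    HasDerivAt (logHeat r) (-(y / (2 * r))) y := by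
  have h2 := (((hasDerivAt_id y).pow 2).div_const (4 * r)).const_sub (-(Real.log r / 2))
  refine h2.congr_deriv ?_
  -- With division by zero equal to zero, both sides vanish at `r = 0`.
  by_cases hr : r = 0
  · simp [hr]
  · simp
    field_simp
    ring

theorem exp_logHeat_le {ε τ r : ℝ} (hε : 0 < ε) (h1 : ε ≤ r) (h2 : r ≤ τ) (y : ℝ) :
    Real.exp (logHeat r y) ≤
      Real.exp (-(Real.log ε / 2)) * Real.exp (-(1 / (4 * τ)) * y ^ 2) := by
  rw [← Real.exp_add, logHeat]
  have hlog := Real.log_le_log hε h1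
  have : 1 / (4 * τ) * y ^ 2 ≤ y ^ 2 / (4 * r) := by
    rw [one_div_mul_eq_div]
    have : 0 < r := hε.trans_le h1
    gcongr
  exact Real.exp_le_exp.2 (by linarith)

/-- The parabolic scaling `y = √r x` moves all dependence on `r` into the argument of `f`, which
removes the singularity of the kernel at `r = 0`. -/
theorem integral_exp_logHeat_mul {r : ℝ} (hr : 0 < r) (f : ℝ → ℂ) :
    ∫ y, (Real.exp (logHeat r y) : ℂ) * f y =
      ∫ x, (Real.exp (-(1 / 4) * x ^ 2) : ℂ) * f (√r * x) := by
  have hs : 0 < √r := Real.sqrt_pos.2 hr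
  have h := Measure.integral_comp_mul_left (fun y => (Real.exp (logHeat r y) : ℂ) * f y) √r
  rw [abs_of_pos (inv_pos.2 hs), eq_inv_smul_iff₀ hs.ne', ← integral_smul] at h
  rw [← h]
  congr 1
  funext x
  rw [Complex.real_smul, ← mul_assoc, ← Complex.ofReal_mul]
  congr 2
  have : √r = Real.exp (Real.log r / 2) := by
    rw [← Real.exp_log hs, Real.log_sqrt hr.le]
  nth_rw 1 [this]
  rw [← Real.exp_add, logHeat, mul_pow, Real.sq_sqrt hr.le]
  congr 1
  field_simp
  ring

/-- At `r = 0` the integral is `f 0` times the Gaussian mass, so continuity there says that the heat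
kernel is an approximate identity. -/
theorem continuous_integral_gaussian_mul_sqrt {f : ℝ → ℂ} (hf : Continuous f) {D : ℝ}
    (hD : ∀ y, ‖f y‖ ≤ D) :
    Continuous fun r : ℝ => ∫ x, (Real.exp (-(1 / 4) * x ^ 2) : ℂ) * f (√r * x) := by
  refine continuous_of_dominated (bound := fun x => Real.exp (-(1 / 4) * x ^ 2) * D)
    (fun r => ?_) (fun r => ?_) ((integrable_exp_neg_mul_sq (by norm_num)).mul_const D) ?_
  · exact Continuous.aestronglyMeasurable (by fun_prop)
  · refine Filter.Eventually.of_forall fun x => ?_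
    rw [norm_mul, Complex.norm_real, Real.norm_eq_abs, Real.abs_exp]
    gcongr
    exact hD _
  · refine Filter.Eventually.of_forall fun x => ?_
    fun_prop

theorem integrable_sq_mul_gaussian {β : ℝ} (hβ : 0 < β) :
    Integrable fun y : ℝ => (1 + y ^ 2) * Real.exp (-β * y ^ 2) := by
  have h := integrable_rpow_mul_exp_neg_mul_sq hβ (s := 2) (by norm_num)
  simp only [Real.rpow_two] at h
  exact ((integrable_exp_neg_mul_sq hβ).add h).congr (Filter.Eventually.of_forall fun y => by
    simp only [Pi.add_apply]
    ring)

/-- The data for the Cole–Hopf transformation: `a` and `b` are a solution of the Burgers equation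
and its derivative, and the last condition says that the antiderivative in space of the solution
satisfies the integrated equation. -/
structure ColeHopf (T : ℝ) (a b : ℝ → ℝ → ℂ) (N : ℝ → ℝ) (w₀ : ℝ → ℂ) (M : ℝ) : Prop where
  pos : 0 < T
  meas_a : StronglyMeasurable fun p : ℝ × ℝ => a p.1 p.2
  meas_b : StronglyMeasurable fun p : ℝ × ℝ => b p.1 p.2
  deriv_a : ∀ s y, HasDerivAt (a s) (b s y) y
  cont_b : ∀ s, Continuous (b s)
  norm_a : ∀ s y, ‖a s y‖ ≤ N s
  norm_b : ∀ s y, ‖b s y‖ ≤ N s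
  int_N : IntervalIntegrable N volume 0 T
  int_N_sq : IntervalIntegrable (fun s => N s ^ 2) volume 0 T
  cont_w₀ : Continuous w₀
  norm_w₀ : ∀ y, ‖w₀ y‖ ≤ M
  space : ∀ᵐ t, t ∈ Ioc 0 T → ∀ y,
    (w₀ y + ∫ s in (0 : ℝ)..t, (b s y - a s y ^ 2 / 2)) =
      (w₀ 0 + ∫ s in (0 : ℝ)..t, (b s 0 - a s 0 ^ 2 / 2)) + ∫ x in (0 : ℝ)..y, a t x

namespace ColeHopf

variable {T : ℝ} {a b : ℝ → ℝ → ℂ} {N : ℝ → ℝ} {w₀ : ℝ → ℂ} {M : ℝ}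

/-- The antiderivative in space of the solution. -/
def pot (a b : ℝ → ℝ → ℂ) (w₀ : ℝ → ℂ) (t y : ℝ) : ℂ :=
  w₀ y + ∫ s in (0 : ℝ)..t, (b s y - a s y ^ 2 / 2)

theorem nonneg_N (h : ColeHopf T a b N w₀ M) (s : ℝ) :
    0 ≤ N s := (norm_nonneg _).trans (h.norm_a s 0)

theorem cont_a (h : ColeHopf T a b N w₀ M) (s : ℝ) : Continuous (a s) :=
  continuous_iff_continuousAt.2 fun y => (h.deriv_a s y).continuousAt

theorem norm_rate_le (h : ColeHopf T a b N w₀ M) (s y : ℝ) :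
    ‖b s y - a s y ^ 2 / 2‖ ≤ N s + N s ^ 2 := by
  have h1 : ‖a s y ^ 2 / 2‖ ≤ N s ^ 2 / 2 := by
    rw [norm_div, norm_pow]
    have := h.norm_a s y
    simp only [Complex.norm_ofNat]
    gcongr
  refine (norm_sub_le _ _).trans (add_le_add (h.norm_b s y) (h1.trans ?_))
  linarith [sq_nonneg (N s)]

theorem int_rate_bound (h : ColeHopf T a b N w₀ M) :
    IntervalIntegrable (fun s => N s + N s ^ 2) volume 0 T :=
  h.int_N.add h.int_N_sq

theorem meas_rate (h : ColeHopf T a b N w₀ M) : StronglyMeasurable fun p :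
    ℝ × ℝ => b p.1 p.2 - a p.1 p.2 ^ 2 / 2 :=
  h.meas_b.sub (by
    simp only [div_eq_mul_inv]
    exact (h.meas_a.pow 2).mul_const (2⁻¹ : ℂ))

theorem int_rate (h : ColeHopf T a b N w₀ M) (y : ℝ) :
    IntervalIntegrable (fun s => b s y - a s y ^ 2 / 2) volume 0 T :=
  h.int_rate_bound.mono_fun
    (h.meas_rate.comp_measurable measurable_prodMk_right).aestronglyMeasurable
    (Filter.Eventually.of_forall fun s => (h.norm_rate_le s y).trans (le_abs_self _))

/-- A bound for the antiderivative. -/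
def potBound (T : ℝ) (N : ℝ → ℝ) (M : ℝ) : ℝ := M + ∫ s in (0 : ℝ)..T, (N s + N s ^ 2)

theorem norm_pot_le (h : ColeHopf T a b N w₀ M) {t : ℝ} (ht : t ∈ Icc 0 T) (y : ℝ) :
    ‖pot a b w₀ t y‖ ≤ potBound T N M := by
  refine (norm_add_le _ _).trans (add_le_add (h.norm_w₀ y) ?_)
  refine (intervalIntegral.norm_integral_le_of_norm_le ht.1
    (Filter.Eventually.of_forall fun s _ => h.norm_rate_le s y)
    (h.int_rate_bound.mono_set ?_)).trans ?_
  · rw [uIcc_of_le ht.1, uIcc_of_le (ht.1.trans ht.2)]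
    exact Icc_subset_Icc le_rfl ht.2
  · refine intervalIntegral.integral_mono_interval le_rfl ht.1 ht.2
      (Filter.Eventually.of_forall fun s => ?_) h.int_rate_bound
    have := h.nonneg_N s
    simp only [Pi.zero_apply]
    positivity

/-- The spatial identity holds only for almost every time and may fail to apply at `T`, so
continuity comes from the time integral by dominated convergence. -/
theorem continuous_pot (h : ColeHopf T a b N w₀ M) : Continuous (pot a b w₀ T) := by
  refine h.cont_w₀.add (intervalIntegral.continuous_of_dominated_interval
    (bound := fun s => N s + N s ^ 2) (fun y => ?_) (fun y => ?_) h.int_rate_bound ?_)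
  · exact (h.meas_rate.comp_measurable measurable_prodMk_right).aestronglyMeasurable
  · exact Filter.Eventually.of_forall fun s _ => h.norm_rate_le s y
  · exact Filter.Eventually.of_forall fun s _ => (h.cont_b s).sub (((h.cont_a s).pow 2).div_const 2)

theorem norm_exp_pot_le (h : ColeHopf T a b N w₀ M) {t : ℝ} (ht : t ∈ Icc 0 T) (y : ℝ) :
    ‖Complex.exp (-(pot a b w₀ t y / 2))‖ ≤ Real.exp (potBound T N M / 2) := by
  rw [Complex.norm_exp]
  refine Real.exp_le_exp.2 ((Complex.re_le_norm _).trans ?_)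
  rw [norm_neg, norm_div, Complex.norm_ofNat]
  linarith [h.norm_pot_le ht y]

theorem meas_pot (h : ColeHopf T a b N w₀ M) :
    AEStronglyMeasurable (fun p : ℝ × ℝ => pot a b w₀ p.1 p.2)
    ((volume.restrict (Ioc 0 T)).prod volume) := by
  -- Writing the variable upper limit as an indicator turns the potential into a parameter integral
  -- of a jointly measurable function.
  set f : (ℝ × ℝ) × ℝ → ℂ := {q | 0 < q.2 ∧ q.2 ≤ q.1.1}.indicator
    fun q => b q.2 q.1.2 - a q.2 q.1.2 ^ 2 / 2
  have hf : StronglyMeasurable f := by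
    refine StronglyMeasurable.indicator ?_ ?_
    · exact h.meas_rate.comp_measurable
        (measurable_snd.prodMk (measurable_snd.comp measurable_fst))
    · exact (measurableSet_lt measurable_const measurable_snd).inter
        (measurableSet_le measurable_snd (measurable_fst.comp measurable_fst))
  have hg : StronglyMeasurable fun p : ℝ × ℝ => w₀ p.2 + ∫ s, f (p, s) :=
    (h.cont_w₀.stronglyMeasurable.comp_measurable measurable_snd).add hf.integral_prod_right'
  refine ⟨_, hg, ?_⟩
  have hmem : ∀ᵐ p : ℝ × ℝ ∂((volume.restrict (Ioc 0 T)).prod volume), p.1 ∈ Ioc 0 T :=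
    Measure.quasiMeasurePreserving_fst.ae (ae_restrict_mem measurableSet_Ioc)
  filter_upwards [hmem] with p hp
  rw [pot, intervalIntegral.integral_of_le hp.1.le, ← integral_indicator measurableSet_Ioc]
  rfl

/-- The integrand of the pairing of the Cole–Hopf transform with a backward heat kernel. -/
def pairing (a b : ℝ → ℝ → ℂ) (w₀ : ℝ → ℂ) (τ s y : ℝ) : ℂ :=
  (Real.exp (logHeat (τ - s) y) : ℂ) * Complex.exp (-(pot a b w₀ s y / 2))

/-- The logarithmic derivative in time of `pairing`. -/
def logRate (a b : ℝ → ℝ → ℂ) (τ s y : ℝ) : ℂ :=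
  ((1 / (2 * (τ - s)) - y ^ 2 / (4 * (τ - s) ^ 2) : ℝ) : ℂ) - (b s y - a s y ^ 2 / 2) / 2

variable {τ : ℝ}

theorem continuousOn_heatRate (hτ : T < τ) (y : ℝ) :
    ContinuousOn (fun s => 1 / (2 * (τ - s)) - y ^ 2 / (4 * (τ - s) ^ 2)) (Iic T) := by
  have : ∀ s ∈ Iic T, τ - s ≠ 0 := fun s hs => by
    have : s ≤ T := hs
    linarith
  refine ContinuousOn.sub ?_ ?_
  · exact continuousOn_const.div (by fun_prop) fun s hs => mul_ne_zero two_ne_zero (this s hs)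
  · exact continuousOn_const.div (by fun_prop) fun s hs =>
      mul_ne_zero four_ne_zero (pow_ne_zero 2 (this s hs))

/-- For fixed `y` the pairing is the exponential of an absolutely continuous function of time; `τ >
T` keeps the kernel away from its singularity. -/
theorem integral_time (h : ColeHopf T a b N w₀ M) (hτ : T < τ) (y : ℝ) :
    ∫ s in (0 : ℝ)..T, logRate a b τ s y * pairing a b w₀ τ s y =
      pairing a b w₀ τ T y - pairing a b w₀ τ 0 y := by
  have hT := h.pos.le
  have hsub : ∀ s ∈ Icc 0 T, uIcc 0 s ⊆ Iic T := fun s hs => by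
    rw [uIcc_of_le hs.1]
    exact fun x hx => hx.2.trans hs.2
  have hi : ∀ s ∈ Icc 0 T, IntervalIntegrable
      (fun s => 1 / (2 * (τ - s)) - y ^ 2 / (4 * (τ - s) ^ 2)) volume 0 s := fun s hs =>
    ((continuousOn_heatRate hτ y).mono (hsub s hs)).intervalIntegrable
  have hiC : ∀ s ∈ Icc 0 T, IntervalIntegrable
      (fun s => ((1 / (2 * (τ - s)) - y ^ 2 / (4 * (τ - s) ^ 2) : ℝ) : ℂ)) volume 0 s :=
    fun s hs => (Complex.continuous_ofReal.comp_continuousOn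
      ((continuousOn_heatRate hτ y).mono (hsub s hs))).intervalIntegrable
  have hi' : ∀ s ∈ Icc 0 T, IntervalIntegrable
      (fun s => (b s y - a s y ^ 2 / 2) / 2) volume 0 s := fun s hs =>
    ((h.int_rate y).mono_set (by
      rw [uIcc_of_le hs.1, uIcc_of_le hT]
      exact Icc_subset_Icc le_rfl hs.2)).div_const 2
  -- The logarithm of the pairing equals its value at `s = 0` plus the integral of `logRate`.
  have hprim : ∀ s ∈ Icc 0 T, Complex.exp (((logHeat τ y : ℝ) : ℂ) - w₀ y / 2 +
      ∫ r in (0 : ℝ)..s, logRate a b τ r y) = pairing a b w₀ τ s y := by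
    intro s hs
    have e1 := intervalIntegral.integral_eq_sub_of_hasDerivAt
      (fun r hr => hasDerivAt_logHeat_time (lt_of_le_of_lt (hsub s hs hr) hτ) y) (hi s hs)
    simp only [logRate]
    rw [intervalIntegral.integral_sub (hiC s hs) (hi' s hs), intervalIntegral.integral_ofReal,
      e1, intervalIntegral.integral_div, pairing, Complex.ofReal_exp, ← Complex.exp_add, pot]
    congr 1
    push_cast
    simp only [sub_zero]
    ring
  have key := integral_mul_exp_integral (p := fun s => logRate a b τ s y)
    (((logHeat τ y : ℝ) : ℂ) - w₀ y / 2)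
    ((hiC T ⟨hT, le_rfl⟩).sub (hi' T ⟨hT, le_rfl⟩) :
      IntervalIntegrable (fun s => logRate a b τ s y) volume 0 T)
  rw [hprim T ⟨hT, le_rfl⟩] at key
  have h0 := hprim 0 ⟨le_rfl, hT⟩
  rw [intervalIntegral.integral_same, add_zero] at h0
  rw [← h0, ← key]
  refine intervalIntegral.integral_congr fun s hs => ?_
  rw [uIcc_of_le hT] at hs
  simp only [hprim s hs]

/-- A constant in the bounds for `pairing`. -/
def pairingBound (T τ : ℝ) (N : ℝ → ℝ) (M : ℝ) : ℝ :=
  Real.exp (-(Real.log (τ - T) / 2)) * Real.exp (potBound T N M / 2)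

theorem norm_pairing_le (h : ColeHopf T a b N w₀ M) (hτ : T < τ) {s : ℝ} (hs : s ∈ Icc 0 T)
    (y : ℝ) : ‖pairing a b w₀ τ s y‖ ≤ pairingBound T τ N M * Real.exp (-(1 / (4 * τ)) * y ^ 2) := by
  rw [pairing, norm_mul, Complex.norm_real, Real.norm_eq_abs, Real.abs_exp, pairingBound,
    mul_right_comm]
  exact mul_le_mul (exp_logHeat_le (by linarith) (by linarith [hs.2]) (by linarith [hs.1]) y)
    (h.norm_exp_pot_le hs y) (norm_nonneg _) (by positivity)

theorem norm_logRate_le (h : ColeHopf T a b N w₀ M) (hτ : T < τ) {s : ℝ} (hs : s ∈ Icc 0 T)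
    (y : ℝ) : ‖logRate a b τ s y‖ ≤
      (1 / (2 * (τ - T)) + 1 / (4 * (τ - T) ^ 2) + (N s + N s ^ 2)) * (1 + y ^ 2) := by
  have hε : 0 < τ - T := by linarith
  have hr : τ - T ≤ τ - s := by linarith [hs.2]
  have hr0 : 0 < τ - s := by linarith
  have hN := h.nonneg_N s
  have b1 : ‖((1 / (2 * (τ - s)) - y ^ 2 / (4 * (τ - s) ^ 2) : ℝ) : ℂ)‖ ≤
      1 / (2 * (τ - T)) + y ^ 2 * (1 / (4 * (τ - T) ^ 2)) := by
    rw [Complex.norm_real]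
    refine (norm_sub_le _ _).trans (add_le_add ?_ ?_)
    · rw [Real.norm_eq_abs, abs_of_pos (by positivity)]
      gcongr
    · rw [Real.norm_eq_abs, abs_of_nonneg (by positivity), mul_one_div]
      gcongr
  have b2 : ‖(b s y - a s y ^ 2 / 2) / 2‖ ≤ N s + N s ^ 2 := by
    rw [norm_div, Complex.norm_ofNat]
    linarith [h.norm_rate_le s y, norm_nonneg (b s y - a s y ^ 2 / 2)]
  refine (norm_sub_le _ _).trans ((add_le_add b1 b2).trans ?_)
  have p1 : 0 ≤ 1 / (2 * (τ - T)) := by positivity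
  have p2 : 0 ≤ 1 / (4 * (τ - T) ^ 2) := by positivity
  nlinarith [mul_nonneg p1 (sq_nonneg y), mul_nonneg hN (sq_nonneg y),
    mul_nonneg (sq_nonneg (N s)) (sq_nonneg y)]

theorem meas_pairing (h : ColeHopf T a b N w₀ M) :
    AEStronglyMeasurable (fun p : ℝ × ℝ => pairing a b w₀ τ p.1 p.2)
    ((volume.restrict (Ioc 0 T)).prod volume) := by
  refine AEStronglyMeasurable.mul ?_ ?_
  · refine (Measurable.aestronglyMeasurable ?_)
    unfold logHeat
    fun_prop
  · exact Complex.continuous_exp.comp_aestronglyMeasurable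
      ((h.meas_pot.mul_const (2⁻¹ : ℂ)).neg.congr (Filter.Eventually.of_forall fun p => by
        simp [div_eq_mul_inv]))

theorem meas_logRate (h : ColeHopf T a b N w₀ M) :
    StronglyMeasurable (fun p : ℝ × ℝ => logRate a b τ p.1 p.2) := by
  have h1 : Measurable fun p : ℝ × ℝ => b p.1 p.2 - a p.1 p.2 ^ 2 / 2 := h.meas_rate.measurable
  refine Measurable.stronglyMeasurable ?_
  unfold logRate
  fun_prop

theorem integrable_rate_mul_pairing (h : ColeHopf T a b N w₀ M) (hτ : T < τ) :
    Integrable (Function.uncurry fun s y => logRate a b τ s y * pairing a b w₀ τ s y)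
      ((volume.restrict (Ioc 0 T)).prod volume) := by
  have hτ0 : 0 < τ := h.pos.trans hτ
  have i1 : Integrable (fun s => 1 / (2 * (τ - T)) + 1 / (4 * (τ - T) ^ 2) + (N s + N s ^ 2))
      (volume.restrict (Ioc 0 T)) := by
    have := (intervalIntegrable_iff_integrableOn_Ioc_of_le h.pos.le).1
      ((intervalIntegrable_const (c := 1 / (2 * (τ - T)) + 1 / (4 * (τ - T) ^ 2))).add
        h.int_rate_bound)
    exact this
  have i2 := (integrable_sq_mul_gaussian (β := 1 / (4 * τ)) (by positivity)).const_mul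
    (pairingBound T τ N M)
  refine (i1.mul_prod i2).mono' (h.meas_logRate.aestronglyMeasurable.mul h.meas_pairing) ?_
  have hmem : ∀ᵐ p : ℝ × ℝ ∂((volume.restrict (Ioc 0 T)).prod volume), p.1 ∈ Ioc 0 T :=
    Measure.quasiMeasurePreserving_fst.ae (ae_restrict_mem measurableSet_Ioc)
  filter_upwards [hmem] with p hp
  have hp' := Ioc_subset_Icc_self hp
  simp only [Function.uncurry]
  rw [norm_mul]
  refine (mul_le_mul (h.norm_logRate_le hτ hp' p.2) (h.norm_pairing_le hτ hp' p.2) (norm_nonneg _)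
    ((norm_nonneg _).trans (h.norm_logRate_le hτ hp' p.2))).trans (le_of_eq ?_)
  ring

/-- With `K` the backward kernel and `ψ = exp(-W/2)`, the time derivative of `K ψ` is `K ψ_yy - K_yy
ψ = (K ψ_y - K_y ψ)_y`, whose integral over the line vanishes by Gaussian decay. -/
theorem ae_integral_space (h : ColeHopf T a b N w₀ M) (hτ : T < τ) : ∀ᵐ s, s ∈ Ioc 0 T →
    ∫ y, logRate a b τ s y * pairing a b w₀ τ s y = 0 := by
  have hint := (integrable_prod_iff (h.integrable_rate_mul_pairing hτ).aestronglyMeasurable).1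
    (h.integrable_rate_mul_pairing hτ) |>.1
  rw [ae_restrict_iff' measurableSet_Ioc] at hint
  filter_upwards [hint, h.space] with s hints hspace hs
  have hs' := Ioc_subset_Icc_self hs
  have hr : 0 < τ - s := by linarith [hs.2]
  have hε : 0 < τ - T := by linarith
  have hτ0 : 0 < τ := h.pos.trans hτ
  have hN := h.nonneg_N s
  have hW : ∀ y, HasDerivAt (pot a b w₀ s) (a s y) y := fun y => by
    have e : pot a b w₀ s = fun y => pot a b w₀ s 0 + ∫ x in (0 : ℝ)..y, a s x :=
      funext fun y => hspace hs y
    rw [e]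
    exact (intervalIntegral.integral_hasDerivAt_right ((h.cont_a s).intervalIntegrable _ _)
      ((h.cont_a s).stronglyMeasurableAtFilter _ _) (h.cont_a s).continuousAt).const_add _
  have hE : ∀ y, HasDerivAt (pairing a b w₀ τ s)
      ((((-(y / (2 * (τ - s))) : ℝ) : ℂ) - a s y / 2) * pairing a b w₀ τ s y) y := fun y => by
    have h2 : HasDerivAt (fun y => -(pot a b w₀ s y / 2)) (-(a s y / 2)) y :=
      ((hW y).div_const 2).neg
    have := ((hasDerivAt_logHeat_space (τ - s) y).exp.ofReal_comp).mul h2.cexp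
    refine this.congr_deriv ?_
    rw [pairing]
    push_cast
    ring
  -- The differentiated function is the flux `K ψ_y - K_y ψ`, using `ψ_y = -(a/2) ψ` and `K_y =
  -- -(y/(2(τ-s))) K`.
  have hF : ∀ y, HasDerivAt
      (fun y => (((y / (2 * (τ - s)) : ℝ) : ℂ) - a s y / 2) * pairing a b w₀ τ s y)
      (logRate a b τ s y * pairing a b w₀ τ s y) y := fun y => by
    have h1 := ((((hasDerivAt_id y).div_const (2 * (τ - s))).ofReal_comp).sub
      ((h.deriv_a s y).div_const 2)).mul (hE y)
    refine h1.congr_deriv ?_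
    have hr' : ((τ : ℂ) - (s : ℂ)) ≠ 0 := by exact_mod_cast hr.ne'
    simp only [id, logRate, Pi.sub_apply]
    push_cast
    field_simp
    ring
  refine integral_eq_zero_of_hasDerivAt_of_integrable hF (hints hs) ?_
  have hc : Continuous (pairing a b w₀ τ s) :=
    continuous_iff_continuousAt.2 fun y => (hE y).continuousAt
  have ha := h.cont_a s
  refine ((integrable_sq_mul_gaussian (β := 1 / (4 * τ)) (by positivity)).const_mul
    ((1 / (2 * (τ - s)) + N s) * pairingBound T τ N M)).mono'
    (Continuous.aestronglyMeasurable (by fun_prop)) (Filter.Eventually.of_forall fun y => ?_)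
  rw [norm_mul]
  have b1 : ‖((y / (2 * (τ - s)) : ℝ) : ℂ) - a s y / 2‖ ≤
      (1 / (2 * (τ - s)) + N s) * (1 + y ^ 2) := by
    refine (norm_sub_le _ _).trans ?_
    rw [Complex.norm_real, norm_div, norm_div, Complex.norm_ofNat, Real.norm_eq_abs,
      Real.norm_eq_abs, abs_of_pos (by positivity : 0 < 2 * (τ - s)), add_mul]
    refine add_le_add ?_ ?_
    · rw [div_eq_mul_one_div, mul_comm]
      gcongr
      nlinarith [sq_abs y, sq_nonneg (|y| - 1)]
    · nlinarith [h.norm_a s y, mul_nonneg hN (sq_nonneg y)]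
  refine (mul_le_mul b1 (h.norm_pairing_le hτ hs' y) (norm_nonneg _) (by positivity)).trans
    (le_of_eq ?_)
  ring

theorem integrable_pairing (h : ColeHopf T a b N w₀ M) (hτ : T < τ) {s : ℝ} (hs : s ∈ Icc 0 T)
    (hm : Continuous (pot a b w₀ s)) : Integrable (pairing a b w₀ τ s) := by
  have hτ0 : 0 < τ := h.pos.trans hτ
  refine ((integrable_exp_neg_mul_sq (b := 1 / (4 * τ)) (by positivity)).const_mul
    (pairingBound T τ N M)).mono' (Continuous.aestronglyMeasurable ?_)
    (Filter.Eventually.of_forall fun y => h.norm_pairing_le hτ hs y)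
  unfold pairing logHeat
  fun_prop

/-- The pairing of the Cole–Hopf transform with a backward heat kernel is conserved. -/
theorem integral_pairing_eq (h : ColeHopf T a b N w₀ M) (hτ : T < τ) :
    ∫ y, pairing a b w₀ τ T y = ∫ y, pairing a b w₀ τ 0 y := by
  have h0 : pot a b w₀ 0 = w₀ := by
    funext y
    simp [pot]
  rw [← sub_eq_zero, ← integral_sub (h.integrable_pairing hτ ⟨h.pos.le, le_rfl⟩ h.continuous_pot)
    (h.integrable_pairing hτ ⟨le_rfl, h.pos.le⟩ (by rw [h0]; exact h.cont_w₀))]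
  simp only [← h.integral_time hτ]
  have hI := h.integrable_rate_mul_pairing hτ
  rw [← uIoc_of_le h.pos.le] at hI
  rw [← intervalIntegral_integral_swap hI]
  refine (intervalIntegral.integral_congr_ae (g := fun _ => 0) ?_).trans (by simp)
  rw [uIoc_of_le h.pos.le]
  exact h.ae_integral_space hτ

open Filter Topology in
/-- The Cole–Hopf formula at the spatial origin. -/
theorem formula (h : ColeHopf T a b N w₀ M) :
    ∫ y, (Real.exp (logHeat T y) : ℂ) * Complex.exp (-(w₀ y / 2)) =
      (∫ x : ℝ, (Real.exp (-(1 / 4) * x ^ 2) : ℂ)) * Complex.exp (-(pot a b w₀ T 0 / 2)) := by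
  have hT := h.pos
  have h0 : ∀ y, pot a b w₀ 0 y = w₀ y := fun y => by simp [pot]
  have c1 := continuous_integral_gaussian_mul_sqrt
    (f := fun y => Complex.exp (-(pot a b w₀ T y / 2)))
    (by have := h.continuous_pot; fun_prop) (h.norm_exp_pot_le ⟨hT.le, le_rfl⟩)
  have c2 := continuous_integral_gaussian_mul_sqrt
    (f := fun y => Complex.exp (-(w₀ y / 2)))
    (by have := h.cont_w₀; fun_prop)
    (fun y => by simpa only [h0] using h.norm_exp_pot_le ⟨le_rfl, hT.le⟩ y)
  have l1 := (c1.tendsto 0).mono_left (nhdsWithin_le_nhds (s := Ioi 0))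
  have l2 := ((c2.comp (continuous_const_add T)).tendsto
    0).mono_left (nhdsWithin_le_nhds (s := Ioi 0))
  -- Conservation is used with `τ = T + ε`. As `ε → 0+`, the kernel at time `T` concentrates at the
  -- origin, while the one at time zero tends to the kernel of age `T`.
  have heq : (fun r : ℝ => ∫ x, (Real.exp (-(1 / 4) * x ^ 2) : ℂ) *
      Complex.exp (-(pot a b w₀ T (√r * x) / 2))) =ᶠ[𝓝[>] 0] (fun r : ℝ =>
      ∫ x, (Real.exp (-(1 / 4) * x ^ 2) : ℂ) * Complex.exp (-(w₀ (√r * x) / 2))) ∘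
      fun ε : ℝ => T + ε := by
    filter_upwards [self_mem_nhdsWithin] with ε hε
    have hε : 0 < ε := hε
    have := h.integral_pairing_eq (τ := T + ε) (by linarith)
    simp only [pairing, add_sub_cancel_left, sub_zero, h0] at this
    rw [integral_exp_logHeat_mul hε (fun y => Complex.exp (-(pot a b w₀ T y / 2))),
      integral_exp_logHeat_mul (by linarith) (fun y => Complex.exp (-(w₀ y / 2)))] at this
    exact this
  have := tendsto_nhds_unique (l2.congr' heq.symm) l1
  simp only [Function.comp, add_zero, Real.sqrt_zero, zero_mul] at this
  rw [integral_exp_logHeat_mul hT (fun y => Complex.exp (-(w₀ y / 2))), this, integral_mul_const]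

end ColeHopf

end

end WickBurgers

/-! ### From the Burgers equation to a moment generating function with entire exponent -/

namespace WickBurgers

noncomputable section

/-- The heat kernel of age `T` is the density of `N(0, 2T)`. -/
theorem exp_logHeat_eq {T : ℝ} (hT : 0 < T) (y : ℝ) :
    Real.exp (logHeat T y) = √(4 * Real.pi) * gaussianPDFReal 0 (2 * T).toNNReal y := by
  have hs : Real.exp (-(Real.log T / 2)) = (√T)⁻¹ := by
    rw [Real.exp_neg, ← Real.log_sqrt hT.le, Real.exp_log (Real.sqrt_pos.2 hT)]
  rw [gaussianPDFReal_def, logHeat, sub_eq_add_neg, Real.exp_add, hs]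
  have h1 : √(2 * Real.pi * (2 * T)) = √(4 * Real.pi) * √T := by
    rw [← Real.sqrt_mul (by positivity)]
    congr 1
    ring
  have h2 : 0 < √(4 * Real.pi) := Real.sqrt_pos.2 (by positivity)
  have h3 : 0 < √T := Real.sqrt_pos.2 hT
  rw [Real.coe_toNNReal _ (by positivity), h1]
  rw [← mul_assoc, mul_inv, mul_inv_cancel_left₀ h2.ne']
  congr 2
  field_simp
  ring

/-- The Cole–Hopf formula at the spatial origin as an identity for a moment generating function. -/
theorem ColeHopf.complexMGF_eq {T : ℝ} {a b : ℝ → ℝ → ℂ} {N : ℝ → ℝ} {Φ : ℝ → ℝ} {ζ : ℂ} {M : ℝ}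
    (h : ColeHopf T a b N (fun y => ζ * Φ y) M) :
    complexMGF Φ (gaussianReal 0 (2 * T).toNNReal) (-(ζ / 2)) =
      Complex.exp (-(ColeHopf.pot a b (fun y => ζ * Φ y) T 0 / 2)) := by
  have hT := h.pos
  have hv : (2 * T).toNNReal ≠ 0 := (Real.toNNReal_pos.2 (by positivity)).ne'
  have hA : (∫ x : ℝ, (Real.exp (-(1 / 4) * x ^ 2) : ℂ)) = (√(4 * Real.pi) : ℂ) := by
    rw [integral_complex_ofReal, integral_gaussian]
    congr 3
    ring
  have hpos : (√(4 * Real.pi) : ℂ) ≠ 0 := by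
    exact_mod_cast (Real.sqrt_pos.2 (by positivity : 0 < 4 * Real.pi)).ne'
  have key := h.formula
  rw [hA] at key
  refine mul_left_cancel₀ hpos (Eq.trans ?_ key)
  rw [complexMGF, integral_gaussianReal_eq_integral_smul hv, ← integral_const_mul]
  congr 1
  funext y
  rw [exp_logHeat_eq hT, Complex.real_smul]
  push_cast
  rw [mul_assoc]
  congr 3
  ring

variable {T : ℝ}

theorem L2H2.integrableOn_norm (v : L2H2 T) : IntegrableOn (fun s => ‖v s‖) (Ioc 0 T) := by
  rw [integrableOn_Ioc_iff_integrableOn_Ioo]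
  exact ((Lp.memLp v).integrable (by norm_num)).norm

theorem L2H2.integrableOn_norm_sq (v : L2H2 T) : IntegrableOn (fun s => ‖v s‖ ^ 2) (Ioc 0 T) := by
  rw [integrableOn_Ioc_iff_integrableOn_Ioo]
  exact (Lp.memLp v).norm.integrable_sq

theorem coleHopf_of_burgers (hT : 0 < T) (v : L2H2 T) (u₀ : L2R) (U : ℝ → L2R) {M : ℝ}
    (hM : ∀ y, ‖∫ x in (0 : ℝ)..y, u₀ x‖ ≤ M)
    (hU : ∀ᵐ t ∂(volume.restrict (Ioo (0 : ℝ) T)), U t = H2.fn (v t))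
    (heq : ∀ t ∈ Icc (0 : ℝ) T, U t + ∫ s in (0 : ℝ)..t, mulL2 (H2.fn (v s)) (H2.dx (v s)) =
      u₀ + ∫ s in (0 : ℝ)..t, H2.dxx (v s)) :
    ColeHopf T (fun s => H2.rep (v s)) (fun s => H2.repDx (v s)) (fun s => 2 * ‖v s‖)
      (fun y => ∫ x in (0 : ℝ)..y, u₀ x) M where
  pos := hT
  meas_a := H2.stronglyMeasurable_rep (Lp.stronglyMeasurable v)
  meas_b := H2.stronglyMeasurable_repDx (Lp.stronglyMeasurable v)
  deriv_a s y := H2.hasDerivAt_rep (v s) y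
  cont_b s := H2.continuous_repDx (v s)
  norm_a s y := H2.norm_rep_le (v s) y
  norm_b s y := H2.norm_repDx_le (v s) y
  int_N := by
    rw [intervalIntegrable_iff_integrableOn_Ioc_of_le hT.le]
    exact (L2H2.integrableOn_norm v).const_mul 2
  int_N_sq := by
    rw [intervalIntegrable_iff_integrableOn_Ioc_of_le hT.le]
    simp only [mul_pow]
    exact (L2H2.integrableOn_norm_sq v).const_mul (2 ^ 2)
  cont_w₀ := continuous_primitive_L2R u₀ 0
  norm_w₀ := hM
  space := by
    rw [← ae_restrict_iff' measurableSet_Ioc, Measure.restrict_congr_set Ioo_ae_eq_Ioc.symm,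
      ae_restrict_iff' measurableSet_Ioo] at *
    have hmeas : StronglyMeasurable v := Lp.stronglyMeasurable v
    have hsub : ∀ t ∈ Icc 0 T, Ioc 0 t ⊆ Ioc 0 T := fun t ht => Ioc_subset_Ioc_right ht.2
    filter_upwards [hU] with t hUt ht y
    have ht' := Ioo_subset_Icc_self ht
    have i1 : IntervalIntegrable (fun s => mulL2 (H2.fn (v s)) (H2.dx (v s))) volume 0 t := by
      rw [intervalIntegrable_iff_integrableOn_Ioc_of_le ht'.1]
      refine (((L2H2.integrableOn_norm_sq v).mono_set (hsub t ht')).const_mul 2).mono'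
        (H2.continuous_mulL2.comp_stronglyMeasurable hmeas).aestronglyMeasurable
        (Filter.Eventually.of_forall fun s => H2.norm_mulL2_le (v s))
    have i2 : IntervalIntegrable (fun s => H2.dxx (v s)) volume 0 t := by
      rw [intervalIntegrable_iff_integrableOn_Ioc_of_le ht'.1]
      refine ((L2H2.integrableOn_norm v).mono_set (hsub t ht')).mono'
        ((H2.comp 2).continuous.comp_stronglyMeasurable hmeas).aestronglyMeasurable
        (Filter.Eventually.of_forall fun s => H2.norm_dxx_le (v s))
    have i3 : ∀ x, IntervalIntegrable (fun s => H2.rep (v s) x ^ 2 / 2) volume 0 t := fun x => by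
      rw [intervalIntegrable_iff_integrableOn_Ioc_of_le ht'.1]
      have hm := (H2.stronglyMeasurable_rep hmeas).comp_measurable
        (measurable_prodMk_right (y := x))
      refine (((L2H2.integrableOn_norm_sq v).mono_set (hsub t ht')).const_mul 2).mono'
        (((hm.pow 2).measurable.div_const 2).aestronglyMeasurable)
        (Filter.Eventually.of_forall fun s => ?_)
      have := H2.norm_rep_le (v s) x
      rw [norm_div, norm_pow, Complex.norm_ofNat]
      have h2 : ‖H2.rep (v s) x‖ ^ 2 ≤ (2 * ‖v s‖) ^ 2 := by gcongr
      linarith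
    have i4 : ∀ x, IntervalIntegrable (fun s => H2.repDx (v s) x) volume 0 t := fun x => by
      rw [intervalIntegrable_iff_integrableOn_Ioc_of_le ht'.1]
      have hm := (H2.stronglyMeasurable_repDx hmeas).comp_measurable
        (measurable_prodMk_right (y := x))
      exact (((L2H2.integrableOn_norm v).mono_set (hsub t ht')).const_mul 2).mono'
        hm.aestronglyMeasurable (Filter.Eventually.of_forall fun s => H2.norm_repDx_le (v s) x)
    -- Integrating the `L₂` equation over `(0, y)` leaves boundary terms of `w²/2` and `w_x`. The
    -- terms at `0` and `y` together are the potential equation.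
    have h1 := congrArg (intervalFunctional 0 y) (heq t ht')
    rw [map_add, map_add, ← (intervalFunctional 0 y).intervalIntegral_comp_comm i1,
      ← (intervalFunctional 0 y).intervalIntegral_comp_comm i2, hUt ht,
      H2.intervalFunctional_fn] at h1
    simp only [H2.intervalFunctional_mulL2, H2.intervalFunctional_dxx, sub_div] at h1
    rw [intervalIntegral.integral_sub (i3 y) (i3 0), intervalIntegral.integral_sub (i4 y) (i4 0),
      intervalFunctional_apply] at h1
    rw [intervalIntegral.integral_sub (i4 y) (i3 y), intervalIntegral.integral_sub (i4 0) (i3 0),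
      intervalIntegral.integral_same]
    linear_combination -h1

/-- A quadratic functional on `L₂(μ; E)` is an entire function of an entire argument. -/
theorem differentiable_integral_sub_sq {α E : Type*} [MeasurableSpace α] [NormedAddCommGroup E]
    [NormedSpace ℂ E] (μ : Measure α) [IsFiniteMeasure μ] (δ₀ δ₁ : E →L[ℂ] ℂ) {V : ℂ → Lp E 2 μ}
    (hV : Differentiable ℂ V) :
    Differentiable ℂ fun ζ => ∫ s, (δ₁ (V ζ s) - δ₀ (V ζ s) ^ 2 / 2) ∂μ := by
  set B := (ContinuousLinearMap.mul ℂ ℂ).lpPairing μ 2 2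
  set c : Lp ℂ 2 μ := Lp.const 2 μ 1
  set L₀ := δ₀.compLpL 2 μ
  set L₁ := δ₁.compLpL 2 μ
  -- The functional is a continuous linear term minus half a continuous bilinear form on the
  -- diagonal, so it preserves holomorphy.
  have key : ∀ v : Lp E 2 μ, ∫ s, (δ₁ (v s) - δ₀ (v s) ^ 2 / 2) ∂μ =
      B c (L₁ v) - B (L₀ v) (L₀ v) / 2 := by
    intro v
    have h0 : L₀ v =ᵐ[μ] fun s => δ₀ (v s) := δ₀.coeFn_compLpL v
    have h1 : L₁ v =ᵐ[μ] fun s => δ₁ (v s) := δ₁.coeFn_compLpL v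
    have hc : c =ᵐ[μ] fun _ => 1 := Lp.coeFn_const 2 μ 1
    have i1 : Integrable (fun s => δ₁ (v s)) μ :=
      ((Lp.memLp (L₁ v)).integrable (by norm_num)).congr h1
    have i2 : Integrable (fun s => δ₀ (v s) ^ 2) μ := by
      refine ((Lp.memLp (L₀ v)).integrable_mul (Lp.memLp (L₀ v))).congr ?_
      filter_upwards [h0] with s hs
      simp [hs, pow_two]
    rw [integral_sub i1 (i2.div_const 2), integral_div,
      ContinuousLinearMap.lpPairing_eq_integral, ContinuousLinearMap.lpPairing_eq_integral]
    congr 1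
    · refine integral_congr_ae ?_
      filter_upwards [h1, hc] with s h1 h2
      rw [h1, h2]
      simp
    · congr 1
      refine integral_congr_ae ?_
      filter_upwards [h0] with s hs
      rw [hs]
      simp [pow_two]
  simp only [key]
  have h0 : Differentiable ℂ fun ζ => L₀ (V ζ) := L₀.differentiable.comp hV
  have h1 : Differentiable ℂ fun ζ => B c (L₁ (V ζ)) := ((B c).comp L₁).differentiable.comp hV
  have h3 : Differentiable ℂ fun ζ => B (L₀ (V ζ)) (L₀ (V ζ)) :=
    (B.differentiable.comp h0).clm_apply h0
  exact h1.sub (h3.div_const 2)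

/-- The potential at the spatial origin is an entire function of an entire solution. -/
theorem differentiable_pot {V : ℂ → L2H2 T} (hT : 0 < T) (hV : Differentiable ℂ V) :
    Differentiable ℂ fun ζ => ∫ s in (0 : ℝ)..T,
      (H2.repDx (V ζ s) 0 - H2.rep (V ζ s) 0 ^ 2 / 2) := by
  have h := differentiable_integral_sub_sq (volume.restrict (Ioo (0 : ℝ) T)) H2.evalZero
    H2.evalDxZero hV
  simp only [H2.evalDxZero_apply, H2.evalZero_apply] at h
  simp only [intervalIntegral.integral_of_le hT.le, integral_Ioc_eq_integral_Ioo]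
  exact h

end

end WickBurgers

/-! ### Hermite moments and the S-transform along a coordinate axis -/

open Polynomial in
theorem integrable_aeval_mul_gaussian (p : ℤ[X]) :
    Integrable fun x : ℝ => aeval x p * Real.exp (-(x ^ 2 / 2)) := by
  induction p using Polynomial.induction_on' with
  | add p q hp hq =>
    simp only [map_add, add_mul]
    exact hp.add hq
  | monomial n a =>
    have h := (integrable_rpow_mul_exp_neg_mul_sq (b := 1 / 2) (by norm_num) (s := n)
      (by linarith [n.cast_nonneg (α := ℝ)])).const_mul (a : ℝ)
    refine h.congr (Filter.Eventually.of_forall fun x => ?_)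
    simp only [aeval_monomial, Real.rpow_natCast, eq_intCast]
    rw [mul_assoc]
    congr 3
    ring

-- The integrand is the derivative of `-p(x) exp(-x²/2)`.
open Polynomial in
theorem integral_aeval_mul_sub_derivative (p : ℤ[X]) :
    ∫ x : ℝ, aeval x (X * p - derivative p) * Real.exp (-(x ^ 2 / 2)) = 0 := by
  refine integral_eq_zero_of_hasDerivAt_of_integrable
    (f := fun x => -(aeval x p * Real.exp (-(x ^ 2 / 2)))) (fun x => ?_)
    (integrable_aeval_mul_gaussian _) (integrable_aeval_mul_gaussian p).neg
  have h1 : HasDerivAt (fun x : ℝ => -(x ^ 2 / 2)) (-x) x := by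
    refine (((hasDerivAt_id x).pow 2).div_const 2).neg.congr_deriv ?_
    simp
  refine ((p.hasDerivAt_aeval x).mul h1.exp).neg.congr_deriv ?_
  simp only [map_sub, map_mul, aeval_X]
  ring

open Polynomial in
/-- The first-order case of the orthogonality of the Hermite polynomials. -/
theorem integral_hermite_mul_id (n : ℕ) :
    ∫ x : ℝ, aeval x (hermite n) * x ∂(gaussianReal 0 1) = if n = 1 then 1 else 0 := by
  have hform : ∀ p : ℤ[X], ∫ x : ℝ, aeval x p ∂(gaussianReal 0 1) =
      (√(2 * Real.pi))⁻¹ * ∫ x : ℝ, aeval x p * Real.exp (-(x ^ 2 / 2)) := fun p => by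
    rw [integral_gaussianReal_eq_integral_smul one_ne_zero, ← integral_const_mul]
    congr 1
    funext x
    simp only [gaussianPDFReal, smul_eq_mul, NNReal.coe_one, mul_one, sub_zero, neg_div]
    ring
  have hzero : ∀ p : ℤ[X], ∫ x : ℝ, aeval x (X * p - derivative p) ∂(gaussianReal 0 1) = 0 :=
    fun p => by rw [hform, integral_aeval_mul_sub_derivative, mul_zero]
  have hint : ∀ p : ℤ[X], Integrable (fun x : ℝ => aeval x p) (gaussianReal 0 1) := fun p => by
    rw [gaussianReal_of_var_ne_zero 0 one_ne_zero,
      integrable_withDensity_iff_integrable_smul' (measurable_gaussianPDF _ _)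
        (Filter.Eventually.of_forall fun _ => ENNReal.ofReal_lt_top)]
    refine ((integrable_aeval_mul_gaussian p).const_mul (√(2 * Real.pi))⁻¹).congr
      (Filter.Eventually.of_forall fun x => ?_)
    simp only [toReal_gaussianPDF, gaussianPDFReal, smul_eq_mul, NNReal.coe_one, mul_one, sub_zero,
      neg_div]
    ring
  have hmean : ∀ n, ∫ x : ℝ, aeval x (hermite n) ∂(gaussianReal 0 1) = if n = 0 then 1 else 0 := by
    rintro (_ | n)
    · simp
    · rw [hermite_succ, hzero, if_neg n.succ_ne_zero]
  rcases n with _ | n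
  · have := hzero 1
    simpa only [mul_one, Polynomial.derivative_one, sub_zero, aeval_X, hermite_zero, C_1, map_one,
      one_mul, zero_ne_one, if_false] using this
  -- Integration by parts reduces the mean of `x He_{n+1}(x)` to that of `He_n`, which is nonzero
  -- only for `n = 0`.
  · have h1 := hzero (X * hermite n)
    have h2 : X * (X * hermite n) - derivative (X * hermite n) =
        hermite (n + 1) * X - hermite n := by
      rw [hermite_succ, derivative_mul, derivative_X]
      ring
    rw [h2] at h1
    simp only [map_sub] at h1
    rw [integral_sub (hint _) (hint _), hmean, sub_eq_zero] at h1
    simpa using h1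

/-- Factorials to a positive power dominate geometric sequences. -/
theorem summable_pow_mul_factorial_rpow {C θ : ℝ} (hC : 0 < C) (hθ : 0 < θ) :
    Summable fun n : ℕ => C ^ n * (n.factorial : ℝ) ^ (-θ) := by
  have hpos : ∀ n : ℕ, 0 < C ^ n * (n.factorial : ℝ) ^ (-θ) := fun n =>
    mul_pos (pow_pos hC n) (Real.rpow_pos_of_pos (by exact_mod_cast n.factorial_pos) _)
  refine summable_of_ratio_test_tendsto_lt_one zero_lt_one
    (Filter.Eventually.of_forall fun n => (hpos n).ne') ?_
  have h1 : Filter.Tendsto (fun n : ℕ => C * ((n + 1 : ℕ) : ℝ) ^ (-θ)) Filter.atTop (nhds 0) := by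
    have := ((tendsto_rpow_neg_atTop hθ).comp
      (tendsto_natCast_atTop_atTop.comp (Filter.tendsto_add_atTop_nat 1))).const_mul C
    simpa using this
  refine h1.congr fun n => ?_
  have hf : (0 : ℝ) < n.factorial := by exact_mod_cast n.factorial_pos
  rw [Real.norm_of_nonneg (hpos _).le, Real.norm_of_nonneg (hpos _).le, eq_div_iff (hpos n).ne',
    Nat.factorial_succ, Nat.cast_mul, Real.mul_rpow (by positivity) hf.le, pow_succ]
  ring

namespace WickBurgers

noncomputable section

variable {ι : Type*}

theorem mpow_single {M : Type*} [CommMonoid M] (z : ι → M) (k : ι) (n : ℕ) :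
    mpow z (Finsupp.single k n) = z k ^ n :=
  Finsupp.prod_single_index (pow_zero _)

theorem mfact_single (k : ι) (n : ℕ) : mfact (Finsupp.single k n) = n.factorial :=
  Finsupp.prod_single_index Nat.factorial_zero

variable [DecidableEq ι]

theorem mpow_piSingle_eq_zero {k : ι} (ζ : ℂ) {α : MIdx ι}
    (hα : α ∉ Set.range fun n : ℕ => Finsupp.single k n) : mpow (Pi.single k ζ) α = 0 := by
  obtain ⟨j, hj, hjk⟩ : ∃ j ∈ α.support, j ≠ k := by
    by_contra! h
    refine hα ⟨α k, ?_⟩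
    ext j
    by_cases hj : j = k
    · simp [hj]
    · rw [Finsupp.single_apply, if_neg (Ne.symm hj)]
      by_contra h0
      exact hj (h j (Finsupp.mem_support_iff.2 (Ne.symm h0)))
  refine Finset.prod_eq_zero hj ?_
  simp only
  rw [Pi.single_eq_of_ne hjk, zero_pow (Finsupp.mem_support_iff.1 hj)]

/-- The S-transform along a coordinate axis. -/
theorem sTransform_piSingle {V : Type*} [NormedAddCommGroup V] [NormedSpace ℂ V] (Φ : MIdx ι → V)
    (k : ι) (ζ : ℂ) : sTransform Φ (Pi.single k ζ) =
      ∑' n : ℕ, (ζ ^ n / (√(n.factorial : ℝ) : ℂ)) • Φ (Finsupp.single k n) := by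
  rw [sTransform, ← (Finsupp.single_injective k).tsum_eq]
  · simp only [mpow_single, mfact_single, Pi.single_eq_same]
  · intro α hα
    by_contra h
    refine hα ?_
    simp only [mpow_piSingle_eq_zero ζ h, zero_div, zero_smul]

/-- The condition `ρ < 1` leaves a factor `(n!)^{-(1-ρ)}` that beats every geometric growth, so the
power series converges on every disc. -/
theorem differentiable_sTransform_piSingle {V : Type*} [NormedAddCommGroup V] [NormedSpace ℂ V]
    [CompleteSpace V] {q : ι → ℝ} (hq : IsWeight q) {ρ ℓ : ℝ} (hρ : ρ < 1) {Φ : MIdx ι → V}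
    (hΦ : MemS q ρ ℓ Φ) (k : ι) : Differentiable ℂ fun ζ => sTransform Φ (Pi.single k ζ) := by
  simp only [sTransform_piSingle]
  have hqk : 0 < q k := zero_lt_one.trans (hq.one_lt k)
  have hS := hΦ.comp_injective (Finsupp.single_injective k)
  simp only [Function.comp_def, mpow_single, mfact_single] at hS
  suffices h : ∀ R : ℝ, 0 < R → DifferentiableOn ℂ (fun ζ => ∑' n : ℕ,
      (ζ ^ n / (√(n.factorial : ℝ) : ℂ)) • Φ (Finsupp.single k n)) (Metric.ball 0 R) by
    intro ζ
    have hR : 0 < ‖ζ‖ + 1 := by positivity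
    exact (h _ hR).differentiableAt (Metric.isOpen_ball.mem_nhds (by simp))
  intro R hR
  have hS' := summable_pow_mul_factorial_rpow (C := R ^ 2 * q k ^ ℓ) (by positivity)
    (sub_pos.2 hρ)
  refine Complex.differentiableOn_tsum_of_summable_norm (hS.add hS') (fun n => ?_)
    Metric.isOpen_ball ?_
  · fun_prop
  · intro n ζ hζ
    have hζ' : ‖ζ‖ ≤ R := by simpa using (Metric.mem_ball.1 hζ).le
    have hf : (0 : ℝ) < n.factorial := by exact_mod_cast n.factorial_pos
    set x := ‖Φ (Finsupp.single k n)‖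
    have hx : 0 ≤ x := norm_nonneg _
    set A := (n.factorial : ℝ) ^ (-ρ) * (q k ^ n) ^ (-ℓ) with hA
    set B := (R ^ 2 * q k ^ ℓ) ^ n * (n.factorial : ℝ) ^ (-(1 - ρ)) with hB
    have hA0 : 0 < A := by positivity
    have hB0 : 0 < B := by positivity
    -- `A` is the weight of the norm and `B` is chosen to complement it, so that `2 √(AB) x ≤ A x² +
    -- B` bounds each term by two summable ones.
    have hAB : A * B = (R ^ n / √(n.factorial : ℝ)) ^ 2 := by
      have e1 : (n.factorial : ℝ) ^ (-ρ) * (n.factorial : ℝ) ^ (-(1 - ρ)) =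
          (n.factorial : ℝ)⁻¹ := by
        rw [← Real.rpow_add hf, ← Real.rpow_neg_one]
        congr 1
        ring
      have e2 : (q k ^ n) ^ (-ℓ) * (q k ^ ℓ) ^ n = 1 := by
        rw [← Real.rpow_natCast, ← Real.rpow_natCast, ← Real.rpow_mul hqk.le,
          ← Real.rpow_mul hqk.le, ← Real.rpow_add hqk]
        convert Real.rpow_zero (q k) using 2
        ring
      calc A * B = ((n.factorial : ℝ) ^ (-ρ) * (n.factorial : ℝ) ^ (-(1 - ρ))) *
          ((q k ^ n) ^ (-ℓ) * (q k ^ ℓ) ^ n) * (R ^ 2) ^ n := by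
            rw [hA, hB, mul_pow]
            ring
        _ = _ := by
            rw [e1, e2, div_pow, Real.sq_sqrt hf.le]
            ring
    have hle : R ^ n / √(n.factorial : ℝ) * x ≤ A * x ^ 2 + B := by
      have h1 : 0 ≤ A * x ^ 2 + B := by positivity
      refine abs_le_of_sq_le_sq' ?_ h1 |>.2
      rw [mul_pow, ← hAB]
      nlinarith [sq_nonneg (A * x ^ 2 - B), mul_pos hA0 hB0, mul_nonneg (mul_pos hA0 hB0).le
        (sq_nonneg x)]
    refine le_trans ?_ hle
    rw [norm_smul, norm_div, norm_pow, Complex.norm_real, Real.norm_of_nonneg (Real.sqrt_nonneg _)]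
    gcongr

-- Only powers of the `k`-th coordinate survive, and the defining sum is the geometric series
-- `x/(1-x)` with `x = q_k^ℓ |ζ|²`.
open Filter Topology in
theorem eventually_piSingle_mem_nbhd {q : ι → ℝ} (hq : IsWeight q) (k : ι) {ℓ R : ℝ} (hR : 0 < R) :
    ∀ᶠ ζ : ℂ in 𝓝 0, (Pi.single k ζ : ι → ℂ) ∈ nbhd q ℓ R := by
  have hqk : 0 < q k := zero_lt_one.trans (hq.one_lt k)
  set x : ℂ → ℝ := fun ζ => q k ^ ℓ * ‖ζ‖ ^ 2 with hxdef
  have hx : Tendsto x (𝓝 0) (𝓝 0) := by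
    have : Continuous x := by fun_prop
    simpa [hxdef] using this.tendsto 0
  have hx2 : Tendsto (fun ζ => x ζ * (1 - x ζ)⁻¹) (𝓝 0) (𝓝 0) := by
    have h := hx.mul ((tendsto_const_nhds (x := (1 : ℝ))).sub hx |>.inv₀ (by simp))
    simpa using h
  filter_upwards [hx.eventually_lt_const zero_lt_one,
    hx2.eventually_lt_const (show (0 : ℝ) < R ^ 2 by positivity)] with ζ h1 h2
  have h0 : 0 ≤ x ζ := by positivity
  let g : ℕ → {α : MIdx ι // α ≠ 0} := fun n =>
    ⟨Finsupp.single k (n + 1), by simp⟩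
  have hg : Function.Injective g := fun m n h => by
    have := Finsupp.single_injective k (congrArg Subtype.val h)
    omega
  set f : {α : MIdx ι // α ≠ 0} → ℝ := fun α =>
    (mpow q α.1) ^ ℓ * ‖mpow (Pi.single k ζ : ι → ℂ) α.1‖ ^ 2 with hf
  have hzero : ∀ α ∉ Set.range g, f α = 0 := by
    intro α hα
    have : mpow (Pi.single k ζ : ι → ℂ) α.1 = 0 := by
      refine mpow_piSingle_eq_zero ζ ?_
      rintro ⟨n, hn⟩
      rcases n with _ | n
      · exact α.2 (by simpa using hn.symm)
      · exact hα ⟨n, Subtype.ext hn⟩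
    simp [hf, this]
  have hfg : f ∘ g = fun n => x ζ * x ζ ^ n := by
    funext n
    simp only [hf, g, Function.comp, mpow_single, Pi.single_eq_same, norm_pow]
    rw [← pow_succ', hxdef]
    simp only [mul_pow]
    rw [← Real.rpow_natCast, ← Real.rpow_mul hqk.le, mul_comm ((n + 1 : ℕ) : ℝ), Real.rpow_mul
      hqk.le, Real.rpow_natCast]
    ring
  have hs : Summable (f ∘ g) := by
    rw [hfg]
    exact (summable_geometric_of_lt_one h0 h1).mul_left _
  refine ⟨(hg.summable_iff hzero).1 hs, ?_⟩
  rw [← hg.tsum_eq fun α hα => by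
    by_contra h
    exact hα (hzero α h)]
  change ∑' n, (f ∘ g) n < R ^ 2
  rw [hfg, tsum_mul_left, tsum_geometric_of_lt_one h0 h1]
  exact h2

/-- The S-transform of `ξ_k F` along the axis of `ξ_k`. -/
theorem sTransform_chaosCoeff_piSingle {Ω V : Type*} [MeasurableSpace Ω] [NormedAddCommGroup V]
    [NormedSpace ℂ V] [CompleteSpace V] (P : Measure Ω) (ξ : ι → Ω → ℝ) (k : ι)
    (hξ : HasLaw (ξ k) (gaussianReal 0 1) P) (F : V) (ζ : ℂ) :
    sTransform (chaosCoeff P ξ fun a => (ξ k a : ℂ) • F) (Pi.single k ζ) = ζ • F := by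
  have hcoef : ∀ n : ℕ, chaosCoeff P ξ (fun a => (ξ k a : ℂ) • F) (Finsupp.single k n) =
      if n = 1 then F else 0 := by
    intro n
    have h1 : ∀ a, (xiBasis ξ (Finsupp.single k n) a : ℂ) • (ξ k a : ℂ) • F =
        (((√(n.factorial : ℝ))⁻¹ *
          ((Polynomial.aeval (ξ k a) (Polynomial.hermite n)) * ξ k a) : ℝ) : ℂ) • F := fun a => by
      rw [smul_smul, xiBasis, mfact_single, Finsupp.prod_single_index (by simp)]
      push_cast
      rw [mul_assoc]
    have h2 := hξ.integral_comp (f := fun x : ℝ => Polynomial.aeval x (Polynomial.hermite n) * x)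
      (by
        refine Measurable.aestronglyMeasurable ?_
        exact (Polynomial.continuous_aeval _).measurable.mul measurable_id)
    simp only [Function.comp_def] at h2
    simp only [chaosCoeff, h1]
    rw [integral_smul_const, integral_complex_ofReal, integral_const_mul, h2,
      integral_hermite_mul_id]
    split_ifs with hn
    · simp [hn]
    · simp
  rw [sTransform_piSingle, tsum_eq_single 1]
  · rw [hcoef, if_pos rfl]
    simp
  · intro n hn
    rw [hcoef, if_neg hn, smul_zero]

end

end WickBurgers

/-! ### Conclusion: a solution of this class forces `φ = 0` -/

namespace WickBurgers

noncomputable section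

theorem integral_testToL2 {φ : ℝ → ℝ} (hφ : ContDiff ℝ ∞ φ) (hc : HasCompactSupport φ) (ζ : ℂ)
    (y : ℝ) : ∫ x in (0 : ℝ)..y, (ζ • testToL2 φ hφ hc : L2R) x =
      ζ * ((∫ x in (0 : ℝ)..y, φ x : ℝ) : ℂ) := by
  rw [← intervalIntegral.integral_ofReal, ← intervalIntegral.integral_const_mul]
  refine intervalIntegral.integral_congr_ae ?_
  filter_upwards [Lp.coeFn_smul ζ (testToL2 φ hφ hc),
    (memLp_of_testFunction hφ.continuous hc).coeFn_toLp] with x h1 h2 _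
  rw [h1, Pi.smul_apply, testToL2, h2, smul_eq_mul]

theorem abs_integral_le_of_hasCompactSupport {φ : ℝ → ℝ} (hφ : Continuous φ)
    (hc : HasCompactSupport φ) (y : ℝ) : |∫ x in (0 : ℝ)..y, φ x| ≤ ∫ x, ‖φ x‖ := by
  have hi := hφ.integrable_of_hasCompactSupport hc (μ := volume)
  have h : ‖∫ x in (0 : ℝ)..y, φ x‖ ≤ ∫ x in uIoc 0 y, ‖φ x‖ :=
    intervalIntegral.norm_integral_le_integral_norm_uIoc
  refine h.trans ?_
  exact setIntegral_le_integral hi.norm (Filter.Eventually.of_forall fun x => norm_nonneg _)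

end

end WickBurgers

open Filter Topology in
theorem mainTheorem2 {ι Ω : Type*} [Countable ι] [MeasurableSpace Ω]
    (P : Measure Ω) [IsProbabilityMeasure P]
    (ξ : ι → Ω → ℝ) (hξ : ∀ k, HasLaw (ξ k) (gaussianReal 0 1) P) (hind : iIndepFun ξ P)
    (q : ι → ℝ) (hq : WickBurgers.IsWeight q)
    (T : ℝ) (hT : 0 < T)
    (φ : ℝ → ℝ) (hφ : ContDiff ℝ ∞ φ) (hφc : HasCompactSupport φ) (hφ0 : φ ≠ 0)
    (k : ι) (ρ ℓ : ℝ) (hρ0 : 0 ≤ ρ) (hρ1 : ρ < 1) (hℓ : 0 < ℓ) :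
    ¬ ∃ u : WickBurgers.MIdx ι → WickBurgers.L2H2 T,
      WickBurgers.MemS q ρ ℓ u ∧
      WickBurgers.IsStrongChaosSolution q T
        (WickBurgers.chaosCoeff P ξ
          (fun a => (ξ k a : ℂ) • WickBurgers.testToL2 φ hφ hφc)) u := by
  classical
  rintro ⟨u, hmem, -, R, ℓ', hR, -, heq⟩
  set Φ : ℝ → ℝ := fun y => ∫ x in (0 : ℝ)..y, φ x with hΦdef
  have hΦ : ∀ y, HasDerivAt Φ (φ y) y := fun y =>
    intervalIntegral.integral_hasDerivAt_right (hφ.continuous.intervalIntegrable _ _)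
      (hφ.continuous.stronglyMeasurableAtFilter _ _) hφ.continuous.continuousAt
  have hΦc : Continuous Φ := continuous_iff_continuousAt.2 fun y => (hΦ y).continuousAt
  have hΦb := WickBurgers.abs_integral_le_of_hasCompactSupport hφ.continuous hφc
  set V : ℂ → WickBurgers.L2H2 T := fun ζ => WickBurgers.sTransform u (Pi.single k ζ)
  have hV : Differentiable ℂ V := WickBurgers.differentiable_sTransform_piSingle hq hρ1 hmem k
  -- This is the potential at time `T` and `x = 0`, since the initial potential `ζ Φ` vanishes at
  -- the origin. It is defined and entire for all `ζ`, although the equation is known only for small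
  -- `ζ`.
  set c : ℂ → ℂ := fun ζ => ∫ s in (0 : ℝ)..T,
    (WickBurgers.H2.repDx (V ζ s) 0 - WickBurgers.H2.rep (V ζ s) 0 ^ 2 / 2)
  have hc : Differentiable ℂ c := WickBurgers.differentiable_pot hT hV
  have hmgf : ∀ᶠ ζ : ℂ in 𝓝 0, complexMGF Φ (gaussianReal 0 (2 * T).toNNReal) (-(ζ / 2)) =
      Complex.exp (-(c ζ / 2)) := by
    filter_upwards [WickBurgers.eventually_piSingle_mem_nbhd hq k (ℓ := ℓ') hR] with ζ hζ
    obtain ⟨U, hU, hUeq⟩ := heq _ hζ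
    rw [WickBurgers.sTransform_chaosCoeff_piSingle P ξ k (hξ k)] at hUeq
    have h := WickBurgers.coleHopf_of_burgers hT (V ζ) _ U (M := ‖ζ‖ * ∫ x, ‖φ x‖) (fun y => by
      rw [WickBurgers.integral_testToL2, norm_mul, Complex.norm_real]
      exact mul_le_mul_of_nonneg_left (hΦb y) (norm_nonneg _)) hU hUeq
    simp only [WickBurgers.integral_testToL2] at h
    rw [h.complexMGF_eq, WickBurgers.ColeHopf.pot]
    simp [c]
  have htend : Tendsto (fun z : ℂ => -(2 * z)) (𝓝 0) (𝓝 0) := by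
    have : Continuous fun z : ℂ => -(2 * z) := by fun_prop
    simpa using this.tendsto 0
  have hv : (2 * T).toNNReal ≠ 0 := (Real.toNNReal_pos.2 (by positivity)).ne'
  have hpos : (gaussianReal 0 (2 * T).toNNReal).IsOpenPosMeasure :=
    (gaussianReal_absolutelyContinuous' 0 hv).isOpenPosMeasure
  -- The substitution `ζ = -2z` turns the argument `-(ζ/2)` into `z`.
  have hconst := eq_of_complexMGF_eq_exp (γ := gaussianReal 0 (2 * T).toNNReal) hΦc hΦb
    (c := fun z => -(c (-(2 * z)) / 2)) (by fun_prop) (by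
      filter_upwards [htend.eventually hmgf] with z hz
      rw [← hz]
      congr 1
      ring)
  refine hφ0 (funext fun y => ?_)
  have h1 : Φ = fun _ => Φ 0 := funext fun x => hconst x 0
  have h2 := hΦ y
  rw [h1] at h2
  exact h2.unique (hasDerivAt_const y _)
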